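/- Let $g$ be a smooth Riemannian metric on the torus $\mathbb T^n=\mathbb R^n/\mathbb Z^n$, lifted to a $\mathbb Z^n$-periodic Riemannian metric on the universal cover $\mathbb R^n$ (still denoted $g$). Let $d_g$ be its Riemannian distance on $\mathbb R^n$ and $\mu_g$ its Riemannian measure. For $\rho>0$ put $\delta_\rho(x)=\rho x$, $g_\rho=\rho^{-2}\,\delta_\rho^*g$, let $\mu_\rho$ be the Riemannian measure of $g_\rho$, and put $$d_\rho(x,y)=\frac{d_g(\rho x,\rho y)}{\rho},\qquad B_\rho(1)=\{x\in\mathbb R^n : d_\rho(0,x)\le 1\}.$$ A net $(X_\alpha,d_\alpha,m_\alpha)$ of compact metric spaces with finite Borel measures converges to $(X,d,m)$ in the measured Gromov–Hausdorff topology if there are positive numbers $\varepsilon_\alpha$ decreasing to $0$ and measurable maps $f_\alpha:X_\alpha\to X$ such that the $\varepsilon_\alpha$-neighbourhood of $f_\alpha(X_\alpha)$ is $X$, $|d_\alpha(x,y)-d(f_\alpha(x),f_\alpha(y))|\le\varepsilon_\alpha$ for all $x,y\in X_\alpha$, and $\int_{X_\alpha}u\circ f_\alpha\,dm_\alpha\to\int_X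 u\,dm$ for every continuous $u:X\to\mathbb R$. **Theorem.** There is a norm $\|\cdot\|_\infty$ on $\mathbb R^n$ (the stable norm of $g$) such that $$\lim_{\rho\to+\infty}\frac{d_g(0,\rho x)}{\rho}=\|x\|_\infty\qquad\text{for all }x\in\mathbb R^n,$$ and, with $B_\infty(1)=\{x\in\mathbb R^n:\|x\|_\infty\le1\}$ and $\mu_\infty$ the multiple of the Lebesgue measure such that $\mu_\infty(D)=\mu_g(D)$ for the fundamental domain $D=[0,1)^n$ of $\mathbb Z^n$, the net of measured metric spaces $(B_\rho(1),d_\rho,\mu_\rho)_{\rho>0}$ converges, as $\rho\to+\infty$, to $(B_\infty(1),\|x-y\|_\infty,\mu_\infty)$ in the measured Gromov–Hausdorff topology. -/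

import Mathlib

open MeasureTheory Filter Topology Set
open scoped Manifold ContDiff ENNReal Bundle

noncomputable section

/-! ### Measured Gromov-Hausdorff convergence -/

/-- A compact metric space with a finite Borel measure. -/
structure CompactMMSpace : Type 1 where
  carrier : Type
  [metricSpace : MetricSpace carrier]
  [compactSpace : CompactSpace carrier]
  [measurableSpace : MeasurableSpace carrier]
  [borelSpace : BorelSpace carrier]
  measure : Measure carrier
  [isFiniteMeasure : IsFiniteMeasure measure]

namespace CompactMMSpace

instance : CoeSort CompactMMSpace Type := ⟨carrier⟩

attribute [instance] metricSpace compactSpace measurableSpace borelSpace isFiniteMeasure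

end CompactMMSpace

/-- `φ : X → Y` is an `ε`-Hausdorff approximation: the `ε`-neighbourhood of `φ(X)` is `Y`, and `φ`
distorts distances by at most `ε`. -/
def IsHausdorffApprox {X Y : Type*} [MetricSpace X] [MetricSpace Y] (ε : ℝ) (φ : X → Y) : Prop :=
  Metric.thickening ε (range φ) = univ ∧
    ∀ x y : X, |dist x y - dist (φ x) (φ y)| ≤ ε

/-- Convergence of a net of compact metric measured spaces in the measured Gromov-Hausdorff
topology. -/
def MGHConverges {A : Type*} [Preorder A] [IsDirectedOrder A] [Nonempty A]
    (X : A → CompactMMSpace) (Y : CompactMMSpace) : Prop :=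
  ∃ (ε : A → ℝ) (f : ∀ a, X a → Y),
    (∀ a, 0 < ε a) ∧ Antitone ε ∧ Tendsto ε atTop (𝓝 0) ∧
    (∀ a, Measurable (f a)) ∧ (∀ a, IsHausdorffApprox (ε a) (f a)) ∧
    ∀ u : C(Y, ℝ), Tendsto (fun a => ∫ x, u (f a x) ∂(X a).measure) atTop
      (𝓝 (∫ y, u y ∂Y.measure))

/-! ### Closed balls of distances on `ℝⁿ` that are bi-Lipschitz to the Euclidean one -/

/-- The Euclidean space `ℝⁿ`. -/
abbrev Eucl (n : ℕ) : Type := EuclideanSpace ℝ (Fin n)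

/-- `d` is a distance on `ℝⁿ` that is bi-Lipschitz equivalent to the Euclidean distance. -/
structure IsBilipDist {n : ℕ} (d : Eucl n → Eucl n → ℝ) : Prop where
  self : ∀ x, d x x = 0
  comm : ∀ x y, d x y = d y x
  triangle : ∀ x y z, d x z ≤ d x y + d y z
  bilip : ∃ α β : ℝ, 0 < α ∧ 0 < β ∧ ∀ x y, α * ‖x - y‖ ≤ d x y ∧ d x y ≤ β * ‖x - y‖

namespace IsBilipDist

variable {n : ℕ} {d : Eucl n → Eucl n → ℝ}

/-- The metric space structure on `ℝⁿ` with distance `d` (and the usual topology). -/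
@[reducible] def metricSpace (hd : IsBilipDist d) : MetricSpace (Eucl n) :=
  MetricSpace.ofDistTopology d hd.self hd.comm hd.triangle
    (by
      obtain ⟨α, β, hα, hβ, h⟩ := hd.bilip
      intro s
      rw [Metric.isOpen_iff]
      refine forall₂_congr fun x _ => ⟨?_, ?_⟩
      · rintro ⟨ε, hε, hs⟩
        refine ⟨α * ε, by positivity, fun y hy => hs ?_⟩
        rw [Metric.mem_ball, dist_comm, dist_eq_norm]
        exact lt_of_mul_lt_mul_left ((h x y).1.trans_lt hy) hα.le
      · rintro ⟨ε, hε, hs⟩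
        refine ⟨ε / β, by positivity, fun y hy => hs y ((h x y).2.trans_lt ?_)⟩
        rw [Metric.mem_ball, dist_comm, dist_eq_norm, lt_div_iff₀ hβ] at hy
        linarith)
    (by
      obtain ⟨α, β, hα, hβ, h⟩ := hd.bilip
      intro x y hxy
      have h1 := (h x y).1
      rw [hxy] at h1
      have h2 : ‖x - y‖ ≤ 0 := by
        by_contra! hc
        nlinarith [mul_pos hα hc]
      exact sub_eq_zero.1 (norm_le_zero_iff.1 h2))

/-- The closed `d`-balls centred at the origin are compact. -/
lemma isCompact_ball (hd : IsBilipDist d) (R : ℝ) : IsCompact {x | d 0 x ≤ R} := by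
  obtain ⟨α, β, hα, hβ, h⟩ := hd.bilip
  have hc : Continuous fun x => d 0 x := by
    refine continuous_iff_continuousAt.2 fun x => ?_
    rw [Metric.continuousAt_iff]
    intro ε hε
    refine ⟨ε / β, by positivity, fun {y} hy => ?_⟩
    rw [dist_eq_norm, lt_div_iff₀ hβ] at hy
    have h1 := hd.triangle 0 x y
    have h2 := hd.triangle 0 y x
    have h3 := (h y x).2
    rw [Real.dist_eq, abs_lt]
    rw [hd.comm x y] at h1
    constructor <;> linarith
  refine (isCompact_closedBall (0 : Eucl n) (R / α)).of_isClosed_subset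
    (isClosed_le hc continuous_const) fun x hx => ?_
  have h1 := (h 0 x).1
  rw [zero_sub, norm_neg] at h1
  rw [mem_closedBall_zero_iff, le_div_iff₀ hα]
  have : d 0 x ≤ R := hx
  linarith

/-- The closed ball `{x | d(0, x) ≤ R}` with the distance `d` and the restriction of `μ`. -/
def closedBall (hd : IsBilipDist d) (μ : Measure (Eucl n)) [IsFiniteMeasureOnCompacts μ] (R : ℝ) :
    CompactMMSpace :=
  letI : MetricSpace {x : Eucl n // d 0 x ≤ R} :=
    @Subtype.metricSpace (Eucl n) (fun x => d 0 x ≤ R) hd.metricSpace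
  haveI : CompactSpace {x : Eucl n // d 0 x ≤ R} :=
    isCompact_iff_compactSpace.1 (hd.isCompact_ball R)
  haveI : BorelSpace {x : Eucl n // d 0 x ≤ R} :=
    Subtype.borelSpace {x : Eucl n | d 0 x ≤ R}
  haveI : IsFiniteMeasure (μ.comap ((↑) : {x : Eucl n // d 0 x ≤ R} → Eucl n)) := by
    refine ⟨?_⟩
    have := comap_subtype_coe_apply (hd.isCompact_ball R).measurableSet μ univ
    rw [image_univ, Subtype.range_coe] at this
    exact this.trans_lt (hd.isCompact_ball R).measure_lt_top
  { carrier := {x : Eucl n // d 0 x ≤ R}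
    measure := μ.comap (↑) }

end IsBilipDist

/-! ### Norms on `ℝⁿ` -/

/-- A norm on the vector space `ℝⁿ`. -/
structure VecNorm (n : ℕ) extends Seminorm ℝ (Eucl n) where
  eq_zero_of_map_eq_zero : ∀ x, toFun x = 0 → x = 0

namespace VecNorm

variable {n : ℕ}

instance : CoeFun (VecNorm n) fun _ => Eucl n → ℝ := ⟨fun N => N.toSeminorm⟩

lemma isBilipDist (N : VecNorm n) : IsBilipDist fun x y => N (x - y) where
  self x := by simp
  comm x y := map_sub_rev N.toSeminorm x y
  triangle x y z := by
    have := map_add_le_add N.toSeminorm (x - y) (y - z)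
    rwa [sub_add_sub_cancel] at this
  bilip := by
    obtain ⟨C, hC, hNC⟩ : ∃ C : ℝ, 0 < C ∧ ∀ x, N x ≤ C * ‖x‖ := by
      let b := (EuclideanSpace.basisFun (Fin n) ℝ).toBasis
      refine ⟨∑ i, N (b i) + 1, ?_, fun x => ?_⟩
      · have : 0 ≤ ∑ i, N (b i) := Finset.sum_nonneg fun i _ => apply_nonneg N.toSeminorm _
        linarith
      · calc N x = N (∑ i, b.repr x i • b i) := by rw [b.sum_repr]
          _ ≤ ∑ i, N (b.repr x i • b i) := Finset.le_sum_of_subadditive N.toSeminorm (map_zero N.toSeminorm).le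
            (map_add_le_add N.toSeminorm) _ _
          _ ≤ ∑ i, N (b i) * ‖x‖ := by
            refine Finset.sum_le_sum fun i _ => ?_
            rw [map_smul_eq_mul, mul_comm]
            refine mul_le_mul_of_nonneg_left ?_ (apply_nonneg N.toSeminorm _)
            simpa [b] using PiLp.norm_apply_le x i
          _ ≤ (∑ i, N (b i) + 1) * ‖x‖ := by
            rw [← Finset.sum_mul, add_mul]
            linarith [norm_nonneg x]
    have hc : Continuous N.toSeminorm := by
      refine (LipschitzWith.of_dist_le_mul (K := C.toNNReal) fun x y => ?_).continuous
      rw [Real.dist_eq, dist_eq_norm, Real.coe_toNNReal _ hC.le]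
      exact (abs_sub_map_le_sub N.toSeminorm x y).trans (hNC _)
    obtain ⟨a, ha, h1⟩ := (isCompact_sphere (0 : Eucl n) 1).exists_forall_le' hc.continuousOn
      (a := 0) (by
        intro v hv
        refine (apply_nonneg N.toSeminorm v).lt_of_ne fun h => ?_
        have : v = 0 := N.eq_zero_of_map_eq_zero v h.symm
        simp [this] at hv)
    refine ⟨a, C, ha, hC, fun x y => ⟨?_, hNC _⟩⟩
    rcases eq_or_ne (x - y) 0 with h | h
    · simp [h]
    have hv' : 0 < ‖x - y‖ := norm_pos_iff.2 h
    have h2 := h1 (‖x - y‖⁻¹ • (x - y)) (by simp [norm_smul, hv'.ne'])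
    rw [map_smul_eq_mul, norm_inv, norm_norm, ← div_eq_inv_mul, le_div_iff₀ hv'] at h2
    exact h2

/-- The closed ball of radius `R` of the norm `N`, with the distance `N (x - y)` and the restriction
of the measure `μ`. -/
def closedBall (N : VecNorm n) (μ : Measure (Eucl n)) [IsFiniteMeasureOnCompacts μ] (R : ℝ) :
    CompactMMSpace :=
  N.isBilipDist.closedBall μ R

end VecNorm

/-! ### Riemannian metrics on `ℝⁿ` -/

section Distance

variable {F : Type*} [NormedAddCommGroup F] [InnerProductSpace ℝ F]

variable (F) in
/-- Smooth Riemannian metrics on the manifold `F`, for a vector space `F`. -/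
abbrev SmoothMetric : Type _ :=
  Bundle.ContMDiffRiemannianMetric 𝓘(ℝ, F) ∞ F (fun x : F => TangentSpace 𝓘(ℝ, F) x)

/-- A smooth field of inner products on a vector space, as a Riemannian metric on the manifold. -/
def riemannianMetricOfForm (form : F → F →L[ℝ] F →L[ℝ] ℝ) (contDiff : ContDiff ℝ ∞ form)
    (symm : ∀ x v w, form x v w = form x w v) (pos : ∀ x v, v ≠ 0 → 0 < form x v v)
    (bdd : ∀ x, Bornology.IsVonNBounded ℝ {v : F | form x v v < 1}) :
    SmoothMetric F where
  inner x := (form x : F →L[ℝ] F →L[ℝ] ℝ)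
  symm x v w := symm x v w
  pos x v hv := pos x v hv
  isVonNBounded x := bdd x
  contMDiff := by
    intro x
    refine (Bundle.contMDiffAt_section _).2 ?_
    refine (contDiff.contMDiff.contMDiffAt (x := x)).congr_of_eventuallyEq ?_
    refine Filter.Eventually.of_forall fun y => ?_
    ext v w
    refine (congrArg (fun p : F × (F →L[ℝ] F →L[ℝ] ℝ) => p.2 v w)
      (hom_trivializationAt_apply (RingHom.id ℝ) (F₁ := F)
        (E₁ := fun x : F => TangentSpace 𝓘(ℝ, F) x) (F₂ := F →L[ℝ] ℝ)
        (E₂ := fun x : F => TangentSpace 𝓘(ℝ, F) x →L[ℝ] ℝ) x ⟨y, form y⟩)).trans ?_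
    simp only [ContinuousLinearMap.inCoordinates, TangentBundle.symmL_model_space,
      ContinuousLinearMap.comp_apply]
    have key (L : F →L[ℝ] ℝ) : (Bundle.Trivialization.continuousLinearMapAt ℝ
        (trivializationAt (F →L[ℝ] ℝ) (fun x : F => TangentSpace 𝓘(ℝ, F) x →L[ℝ] ℝ) x) y
          (L : TangentSpace 𝓘(ℝ, F) y →L[ℝ] ℝ) : F →L[ℝ] ℝ) w = L w := by
      have hm : y ∈ (trivializationAt (F →L[ℝ] ℝ)
          (fun x : F => TangentSpace 𝓘(ℝ, F) x →L[ℝ] ℝ) x).baseSet := by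
        simp [chartAt_self_eq]
      have h1 := congrFun (Bundle.Trivialization.coe_linearMapAt_of_mem (R := ℝ) _ hm)
        (L : TangentSpace 𝓘(ℝ, F) y →L[ℝ] ℝ)
      refine (congrArg (fun M : F →L[ℝ] ℝ => M w) h1).trans ?_
      refine (congrArg (fun p : F × (F →L[ℝ] ℝ) => p.2 w)
        (hom_trivializationAt_apply (RingHom.id ℝ) (F₁ := F)
          (E₁ := fun x : F => TangentSpace 𝓘(ℝ, F) x) (F₂ := ℝ)
          (E₂ := fun _ : F => ℝ) x ⟨y, L⟩)).trans ?_
      simp only [ContinuousLinearMap.inCoordinates, TangentBundle.symmL_model_space,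
        ContinuousLinearMap.comp_apply]
      simp
      rfl
    exact key (form y v)

/-- The Riemannian distance of a Riemannian metric on a vector space, that is the infimum of the
lengths of the `C¹` paths. -/
def riemannianEDistOf (g : SmoothMetric F) (x y : F) : ℝ≥0∞ :=
  letI : Bundle.RiemannianBundle (fun x : F => TangentSpace 𝓘(ℝ, F) x) := ⟨g.toRiemannianMetric⟩
  Manifold.riemannianEDist 𝓘(ℝ, F) x y

lemma riemannianEDistOf_eq (g : SmoothMetric F) (x y : F) : riemannianEDistOf g x y =
      ⨅ (γ : Path x y) (_ : ContMDiff (𝓡∂ 1) 𝓘(ℝ, F) 1 γ), ∫⁻ t, ENNReal.ofReal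
        √(g.inner (γ t) (mfderiv (𝓡∂ 1) 𝓘(ℝ, F) γ t 1) (mfderiv (𝓡∂ 1) 𝓘(ℝ, F) γ t 1)) := by
  let : Bundle.RiemannianBundle (fun x : F => TangentSpace 𝓘(ℝ, F) x) := ⟨g.toRiemannianMetric⟩
  have h (z : F) (v : TangentSpace 𝓘(ℝ, F) z) : ‖v‖ₑ = ENNReal.ofReal √(g.inner z v v) := by
    rw [← ofReal_norm, norm_eq_sqrt_real_inner]
    rfl
  change Manifold.riemannianEDist 𝓘(ℝ, F) x y = _
  rw [Manifold.riemannianEDist]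
  simp only [h]

lemma riemannianEDistOf_self (g : SmoothMetric F) (x : F) : riemannianEDistOf g x x = 0 := by
  let : Bundle.RiemannianBundle (fun x : F => TangentSpace 𝓘(ℝ, F) x) := ⟨g.toRiemannianMetric⟩
  exact Manifold.riemannianEDist_self

lemma riemannianEDistOf_comm (g : SmoothMetric F) (x y : F) : riemannianEDistOf g x y = riemannianEDistOf g y x := by
  let : Bundle.RiemannianBundle (fun x : F => TangentSpace 𝓘(ℝ, F) x) := ⟨g.toRiemannianMetric⟩
  exact Manifold.riemannianEDist_comm

lemma riemannianEDistOf_triangle (g : SmoothMetric F) (x y z : F) :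
    riemannianEDistOf g x z ≤ riemannianEDistOf g x y + riemannianEDistOf g y z := by
  let : Bundle.RiemannianBundle (fun x : F => TangentSpace 𝓘(ℝ, F) x) := ⟨g.toRiemannianMetric⟩
  exact Manifold.riemannianEDist_triangle

/-- A pointwise comparison of two Riemannian metrics gives a comparison of the distances. -/
lemma riemannianEDistOf_le
    (g h : SmoothMetric F)
    {c : ℝ} (hc : 0 < c)
    (hgh : ∀ (x : F) (v : TangentSpace 𝓘(ℝ, F) x), g.inner x v v ≤ c ^ 2 * h.inner x v v)
    (x y : F) : riemannianEDistOf g x y ≤ ENNReal.ofReal c * riemannianEDistOf h x y := by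
  rw [riemannianEDistOf_eq, riemannianEDistOf_eq,
    ENNReal.mul_iInf_of_ne (by simpa using hc) ENNReal.ofReal_ne_top]
  refine iInf_mono fun γ => ?_
  rw [ENNReal.mul_iInf_of_ne (by simpa using hc) ENNReal.ofReal_ne_top]
  refine iInf_mono fun _ => ?_
  rw [← lintegral_const_mul' _ _ ENNReal.ofReal_ne_top]
  refine lintegral_mono fun t => ?_
  rw [← ENNReal.ofReal_mul hc.le]
  refine ENNReal.ofReal_le_ofReal (Real.sqrt_le_iff.2 ⟨by positivity, ?_⟩)
  have hpos (v : TangentSpace 𝓘(ℝ, F) (γ t)) : 0 ≤ h.inner (γ t) v v := by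
    rcases eq_or_ne v 0 with rfl | hv
    · simp
    · exact (h.pos _ v hv).le
  rw [mul_pow, Real.sq_sqrt (hpos _)]
  exact hgh _ _

lemma riemannianEDistOf_vectorSpace (x y : F) :
    riemannianEDistOf (F := F) { riemannianMetricVectorSpace F with
      contMDiff := (riemannianMetricVectorSpace F).contMDiff.of_le (by simp) } x y
      = edist x y := by
  exact (IsRiemannianManifold.out (I := 𝓘(ℝ, F)) x y).symm

end Distance

/-- A smooth Riemannian metric on `ℝⁿ`. -/
structure RiemMetric (n : ℕ) where
  form : Eucl n → Eucl n →L[ℝ] Eucl n →L[ℝ] ℝ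
  contDiff : ContDiff ℝ ∞ form
  symm : ∀ x v w, form x v w = form x w v
  pos : ∀ x v, v ≠ 0 → 0 < form x v v

namespace RiemMetric

variable {n : ℕ}

/-- `g` is invariant under the translations by `ℤⁿ`, that is, `g` is the lift to the universal cover
`ℝⁿ` of a Riemannian metric on the torus `𝕋ⁿ = ℝⁿ / ℤⁿ`. -/
def IsPeriodic (g : RiemMetric n) : Prop :=
  ∀ (k : Fin n → ℤ) (x : Eucl n), g.form (x + WithLp.toLp 2 fun i => (k i : ℝ)) = g.form x

lemma exists_bounds_on (g : RiemMetric n) {K : Set (Eucl n)} (hK : IsCompact K) :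
    ∃ α β : ℝ, 0 < α ∧ 0 < β ∧
      ∀ x ∈ K, ∀ v, (α * ‖v‖) ^ 2 ≤ g.form x v v ∧ g.form x v v ≤ (β * ‖v‖) ^ 2 := by
  have hq : Continuous fun p : Eucl n × Eucl n => g.form p.1 p.2 p.2 := by
    have := g.contDiff.continuous
    fun_prop
  have hS : IsCompact (K ×ˢ Metric.sphere (0 : Eucl n) 1) := hK.prod (isCompact_sphere _ _)
  obtain ⟨a, ha, h1⟩ := hS.exists_forall_le' hq.continuousOn (a := 0) (by
    rintro ⟨x, v⟩ ⟨-, hv⟩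
    refine g.pos x v ?_
    rintro rfl
    simp at hv)
  obtain ⟨b, h2⟩ := hS.bddAbove_image hq.continuousOn
  refine ⟨√a, √(max b 1), by positivity, by positivity, fun x hx v => ?_⟩
  rw [mul_pow, mul_pow, Real.sq_sqrt ha.le, Real.sq_sqrt (by positivity)]
  rcases eq_or_ne v 0 with rfl | hv
  · simp
  have hv' : 0 < ‖v‖ := norm_pos_iff.2 hv
  have hu : (x, ‖v‖⁻¹ • v) ∈ K ×ˢ Metric.sphere (0 : Eucl n) 1 :=
    ⟨hx, by simp [norm_smul, hv'.ne']⟩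
  have h1' := h1 _ hu
  have h2' := (h2 (mem_image_of_mem _ hu)).trans (le_max_left b 1)
  simp only [map_smul, smul_eq_mul, _root_.smul_apply] at h1' h2'
  have e : g.form x v v = ‖v‖⁻¹ * (‖v‖⁻¹ * g.form x v v) * ‖v‖ ^ 2 := by
    field_simp
  rw [e]
  exact ⟨by gcongr, by gcongr⟩

lemma IsPeriodic.exists_bounds {g : RiemMetric n} (hg : g.IsPeriodic) :
    ∃ α β : ℝ, 0 < α ∧ 0 < β ∧
      ∀ x v, (α * ‖v‖) ^ 2 ≤ g.form x v v ∧ g.form x v v ≤ (β * ‖v‖) ^ 2 := by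
  have hK : IsCompact (WithLp.toLp 2 '' (univ.pi fun _ : Fin n => Icc (0 : ℝ) 1)) :=
    (isCompact_univ_pi fun _ => isCompact_Icc).image (PiLp.continuous_toLp 2 _)
  obtain ⟨α, β, hα, hβ, h⟩ := g.exists_bounds_on hK
  refine ⟨α, β, hα, hβ, fun x v => ?_⟩
  have hx : x = WithLp.toLp 2 (fun i => Int.fract (x i)) +
      WithLp.toLp 2 (fun i => ((⌊x i⌋ : ℤ) : ℝ)) := by
    ext i
    simp
  rw [hx, hg]
  exact h _ ⟨_, fun i _ => ⟨Int.fract_nonneg _, (Int.fract_lt_one _).le⟩, rfl⟩ v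

/-- `g` as a Riemannian metric on the manifold `ℝⁿ`. -/
def toContMDiff (g : RiemMetric n) : SmoothMetric (Eucl n) :=
  riemannianMetricOfForm g.form g.contDiff g.symm g.pos fun x => by
    obtain ⟨α, β, hα, hβ, h⟩ := g.exists_bounds_on (isCompact_singleton (x := x))
    refine (NormedSpace.isVonNBounded_closedBall ℝ (Eucl n) α⁻¹).subset fun v hv => ?_
    have h1 := (h x rfl v).1
    have h2 : g.form x v v < 1 := hv
    have h3 : α * ‖v‖ ≤ 1 := by
      by_contra! hc
      nlinarith
    rw [mem_closedBall_zero_iff, ← one_div, le_div_iff₀ hα]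
    linarith

/-- The Riemannian distance `d_g`. -/
def dist (g : RiemMetric n) (x y : Eucl n) : ℝ := (riemannianEDistOf g.toContMDiff x y).toReal

/-- The rescaled distance `d_ρ(x, y) = d_g(ρ x, ρ y) / ρ`. -/
def rescaledDist (g : RiemMetric n) (ρ : ℝ) (x y : Eucl n) : ℝ := g.dist (ρ • x) (ρ • y) / ρ

lemma IsPeriodic.isBilipDist {g : RiemMetric n} (hg : g.IsPeriodic) : IsBilipDist g.dist := by
  obtain ⟨α, β, hα, hβ, h⟩ := hg.exists_bounds
  let g₀ : SmoothMetric (Eucl n) := { riemannianMetricVectorSpace (Eucl n) with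
      contMDiff := (riemannianMetricVectorSpace (Eucl n)).contMDiff.of_le (by simp) }
  have h₀ (x y : Eucl n) : riemannianEDistOf g₀ x y = edist x y := riemannianEDistOf_vectorSpace x y
  have hin (x v : Eucl n) : g₀.inner x v v = ‖v‖ ^ 2 := real_inner_self_eq_norm_sq v
  have hup (x y : Eucl n) :
      riemannianEDistOf g.toContMDiff x y ≤ ENNReal.ofReal β * edist x y := by
    rw [← h₀]
    refine riemannianEDistOf_le _ _ hβ (fun z v => ?_) x y
    have := (h z v).2
    rw [mul_pow, ← hin z v] at this
    exact this
  have hlo (x y : Eucl n) :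
      edist x y ≤ ENNReal.ofReal α⁻¹ * riemannianEDistOf g.toContMDiff x y := by
    rw [← h₀]
    refine riemannianEDistOf_le _ _ (inv_pos.2 hα) (fun z v => ?_) x y
    have h1 := (h z v).1
    rw [mul_pow, ← hin z v] at h1
    rw [inv_pow, ← div_eq_inv_mul, le_div_iff₀ (by positivity), mul_comm]
    exact h1
  have hne (x y : Eucl n) : riemannianEDistOf g.toContMDiff x y ≠ ⊤ :=
    ((hup x y).trans_lt (ENNReal.mul_lt_top ENNReal.ofReal_lt_top (edist_lt_top x y))).ne
  refine ⟨fun x => ?_, fun x y => ?_, fun x y z => ?_, α, β, hα, hβ, fun x y => ⟨?_, ?_⟩⟩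
  · simp [dist, riemannianEDistOf_self]
  · rw [dist, riemannianEDistOf_comm, dist]
  · rw [dist, dist, dist, ← ENNReal.toReal_add (hne _ _) (hne _ _)]
    exact ENNReal.toReal_mono (ENNReal.add_ne_top.2 ⟨hne _ _, hne _ _⟩)
      (riemannianEDistOf_triangle _ x y z)
  · have := ENNReal.toReal_mono (ENNReal.mul_ne_top ENNReal.ofReal_ne_top (hne x y)) (hlo x y)
    rw [ENNReal.toReal_mul, ENNReal.toReal_ofReal (by positivity), edist_dist,
      ENNReal.toReal_ofReal dist_nonneg, dist_eq_norm, ← div_eq_inv_mul, le_div_iff₀ hα] at this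
    rw [mul_comm]
    exact this
  · have := ENNReal.toReal_mono (ENNReal.mul_ne_top ENNReal.ofReal_ne_top (edist_ne_top x y))
      (hup x y)
    rwa [ENNReal.toReal_mul, ENNReal.toReal_ofReal hβ.le, edist_dist,
      ENNReal.toReal_ofReal dist_nonneg, dist_eq_norm] at this

lemma IsPeriodic.isBilipDist_rescaledDist {g : RiemMetric n} (hg : g.IsPeriodic) {ρ : ℝ}
    (hρ : 0 < ρ) : IsBilipDist (g.rescaledDist ρ) := by
  obtain ⟨α, β, hα, hβ, h⟩ := hg.isBilipDist.bilip
  refine ⟨fun x => ?_, fun x y => ?_, fun x y z => ?_, α, β, hα, hβ, fun x y => ?_⟩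
  · simp [rescaledDist, hg.isBilipDist.self]
  · rw [rescaledDist, hg.isBilipDist.comm, rescaledDist]
  · rw [rescaledDist, rescaledDist, rescaledDist, ← add_div]
    have := hg.isBilipDist.triangle (ρ • x) (ρ • y) (ρ • z)
    gcongr
  · have := h (ρ • x) (ρ • y)
    rw [← smul_sub, norm_smul, Real.norm_of_nonneg hρ.le] at this
    rw [rescaledDist, le_div_iff₀ hρ, div_le_iff₀ hρ]
    constructor <;> linarith [this.1, this.2]

/-- The Riemannian measure of `g`, with density `√det(g(eᵢ, eⱼ))` with respect to the Lebesgue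
measure. -/
def measure (g : RiemMetric n) : Measure (Eucl n) :=
  (volume : Measure (Eucl n)).withDensity fun x => ENNReal.ofReal
    √(Matrix.det (Matrix.of fun i j : Fin n =>
      g.form x (EuclideanSpace.single i 1) (EuclideanSpace.single j 1)))

instance (g : RiemMetric n) : IsLocallyFiniteMeasure g.measure := by
  refine IsLocallyFiniteMeasure.withDensity_ofReal (Real.continuous_sqrt.comp ?_)
  refine Continuous.matrix_det (continuous_matrix fun i j => ?_)
  have := g.contDiff.continuous
  simp only [Matrix.of_apply]
  fun_prop

/-- The pull-back `δ_ρ^* h` of a bilinear form `h` at `ρ x` by the homothety `δ_ρ : x ↦ ρ x`. -/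
def homothetyPullback (ρ : ℝ) (x : Eucl n) (h : Eucl n →L[ℝ] Eucl n →L[ℝ] ℝ) :
    Eucl n →L[ℝ] Eucl n →L[ℝ] ℝ :=
  h.bilinearComp (fderiv ℝ (fun y : Eucl n => ρ • y) x) (fderiv ℝ (fun y : Eucl n => ρ • y) x)

lemma smul_homothetyPullback {ρ : ℝ} (hρ : 0 < ρ) (x : Eucl n)
    (h : Eucl n →L[ℝ] Eucl n →L[ℝ] ℝ) : (1 / ρ ^ 2) • homothetyPullback ρ x h = h := by
  have h1 : fderiv ℝ (fun y : Eucl n => ρ • y) x = ρ • ContinuousLinearMap.id ℝ (Eucl n) := by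
    rw [fderiv_fun_const_smul differentiableAt_fun_id, fderiv_fun_id]
  ext v w
  have := hρ.ne'
  simp [homothetyPullback, h1]
  field_simp

/-- The rescaled metric `g_ρ = (1 / ρ²) (δ_ρ)^* g`, where `δ_ρ` is the homothety `x ↦ ρ x`. -/
def rescale (g : RiemMetric n) (ρ : ℝ) (hρ : 0 < ρ) : RiemMetric n where
  form x := (1 / ρ ^ 2) • homothetyPullback ρ x (g.form (ρ • x))
  contDiff := by
    simp only [smul_homothetyPullback hρ]
    exact g.contDiff.comp (contDiff_const_smul ρ)
  symm x v w := by
    simp only [smul_homothetyPullback hρ]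
    exact g.symm _ v w
  pos x v hv := by
    simp only [smul_homothetyPullback hρ]
    exact g.pos _ v hv

/-- The measured metric ball `(B_ρ(R), d_ρ, μ_ρ)`, where `B_ρ(R) = {x | d_ρ(0, x) ≤ R}` and `μ_ρ` is
the Riemannian measure of the rescaled metric `g_ρ`. -/
def rescaledBall (g : RiemMetric n) (hg : g.IsPeriodic) (ρ : ℝ) (hρ : 0 < ρ) (R : ℝ) :
    CompactMMSpace :=
  (hg.isBilipDist_rescaledDist hρ).closedBall (g.rescale ρ hρ).measure R

/-- `N` is the stable norm of `g`: `N x = lim d_g(0, ρ x) / ρ` as `ρ → +∞`. -/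
def IsStableNorm (g : RiemMetric n) (N : VecNorm n) : Prop :=
  ∀ x : Eucl n, Tendsto (fun ρ : ℝ => g.dist 0 (ρ • x) / ρ) atTop (𝓝 (N x))

/-- The fundamental domain `[0, 1)ⁿ` of the action of `ℤⁿ` on `ℝⁿ`. -/
def fundDomain (n : ℕ) : Set (Eucl n) :=
  ZSpan.fundamentalDomain (EuclideanSpace.basisFun (Fin n) ℝ).toBasis

/-- The multiple `μ_∞` of the Lebesgue measure that gives to the fundamental domain `D` the
mass `μ_g(D)`. -/
def limitMeasure (g : RiemMetric n) : Measure (Eucl n) :=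
  (g.measure (fundDomain n) / volume (fundDomain n)) • volume

lemma volume_fundDomain_ne_zero : (volume : Measure (Eucl n)) (fundDomain n) ≠ 0 :=
  ZSpan.measure_fundamentalDomain_ne_zero _

lemma measure_fundDomain_ne_top (μ : Measure (Eucl n)) [IsLocallyFiniteMeasure μ] :
    μ (fundDomain n) ≠ ⊤ :=
  (ZSpan.fundamentalDomain_isBounded _).measure_lt_top.ne

lemma limitMeasure_fundDomain (g : RiemMetric n) :
    g.limitMeasure (fundDomain n) = g.measure (fundDomain n) := by
  rw [limitMeasure, Measure.smul_apply, smul_eq_mul]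
  exact ENNReal.div_mul_cancel volume_fundDomain_ne_zero (measure_fundDomain_ne_top _)

instance (g : RiemMetric n) : IsFiniteMeasureOnCompacts g.limitMeasure :=
  IsFiniteMeasureOnCompacts.smul _
    (ENNReal.div_ne_top (measure_fundDomain_ne_top _) volume_fundDomain_ne_zero)

end RiemMetric

end

/-!
The distance `d_g` is invariant under the lattice `ℤⁿ`, whose fundamental domain is bounded, so it
is invariant under all translations up to a bounded error. Hence `x ↦ d_g(0, x)` is subadditive up
to a bounded error, and Fekete's argument gives the limit norm. As the rescaled distances are
equi-Lipschitz, they converge to it locally uniformly, and the radial retraction onto the unit ball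
of the limit norm is a Hausdorff approximation.

For the measures, let `ν` be a Haar measure and `μ` a measure invariant under the lattice, with
fundamental domain `D`. The image of `ν ⊗ μ|_D` under `(x, s) ↦ ⌊x⌋ + s` is `ν(D) μ`, so the
integrals against the rescaled measures are averages over the points `ρ⁻¹ (⌊ρ x⌋ + s)`. These tend
to `x`, and dominated convergence applies because the spheres of a norm are null sets.
-/

open scoped NNReal

section StableSeminorm

variable {E : Type*} [SeminormedAddCommGroup E] [NormedSpace ℝ E]

lemma tendsto_div_atTop_of_lipschitzWith {f : ℝ → ℝ} {K : ℝ≥0} (hf : LipschitzWith K f)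
    {L : ℝ} (hL : Tendsto (fun k : ℕ => f k / k) atTop (𝓝 L)) :
    Tendsto (fun t => f t / t) atTop (𝓝 L) := by
  have hfloor : Tendsto (fun t : ℝ => f ⌊t⌋₊ / ⌊t⌋₊ * (⌊t⌋₊ / t)) atTop (𝓝 L) := by
    simpa using (hL.comp tendsto_nat_floor_atTop).mul (tendsto_nat_floor_div_atTop (R := ℝ))
  have herror : Tendsto (fun t : ℝ => (f t - f ⌊t⌋₊) / t) atTop (𝓝 0) := by
    refine squeeze_zero_norm' ?_ (tendsto_const_nhds.div_atTop tendsto_id : Tendsto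
      (fun t : ℝ => (K : ℝ) / t) atTop (𝓝 0))
    filter_upwards [eventually_gt_atTop 0] with t ht
    have hfract : ‖t - ⌊t⌋₊‖ ≤ 1 := by
      rw [Real.norm_of_nonneg (sub_nonneg.2 (Nat.floor_le ht.le))]
      linarith [Nat.lt_floor_add_one t]
    rw [norm_div, Real.norm_of_nonneg ht.le]
    gcongr
    exact (hf.norm_sub_le _ _).trans (mul_le_of_le_one_right K.2 hfract)
  refine (by simpa using hfloor.add herror : Tendsto _ atTop (𝓝 L)).congr' ?_
  filter_upwards [eventually_ge_atTop 1] with t ht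
  have : (⌊t⌋₊ : ℝ) ≠ 0 := by exact_mod_cast (Nat.floor_pos.2 ht).ne'
  field_simp
  ring

lemma exists_tendsto_div_atTop_of_almost_subadditive {f : ℝ → ℝ} {K : ℝ≥0}
    (hf : LipschitzWith K f) {C : ℝ} (hadd : ∀ s t, f (s + t) ≤ f s + f t + C) :
    ∃ L, Tendsto (fun t => f t / t) atTop (𝓝 L) := by
  have hsub : Subadditive fun k : ℕ => f k + C := fun k l => by
    have := hadd k l
    push_cast
    linarith
  have hbdd : BddBelow (range fun k : ℕ => (f k + C) / k) := by
    refine ⟨-(K + |f 0 + C|), ?_⟩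
    rintro _ ⟨k, rfl⟩
    rcases k.eq_zero_or_pos with rfl | hk
    · simp only [Nat.cast_zero, div_zero, neg_nonpos]
      positivity
    have hk : (1 : ℝ) ≤ k := by exact_mod_cast hk
    have hgrowth := (abs_le.1 (hf.norm_sub_le k 0)).1
    rw [sub_zero, Real.norm_of_nonneg (by positivity)] at hgrowth
    have hC := neg_abs_le (f 0 + C)
    rw [le_div_iff₀ (by positivity)]
    nlinarith [abs_nonneg (f 0 + C)]
  refine ⟨hsub.lim, tendsto_div_atTop_of_lipschitzWith hf ?_⟩
  have hconst : Tendsto (fun k : ℕ => C / k) atTop (𝓝 0) :=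
    tendsto_const_nhds.div_atTop tendsto_natCast_atTop_atTop
  simpa [add_div] using (hsub.tendsto_lim hbdd).sub hconst

lemma asymptoticLimit_smul_of_nonneg {f N : E → ℝ}
    (hlim : ∀ x, Tendsto (fun ρ : ℝ => f (ρ • x) / ρ) atTop (𝓝 (N x))) {c : ℝ} (hc : 0 ≤ c)
    (x : E) : N (c • x) = c * N x := by
  rcases hc.eq_or_lt with rfl | hc
  · rw [zero_mul]
    refine tendsto_nhds_unique (hlim _) ?_
    simpa using (tendsto_const_nhds.div_atTop tendsto_id :
      Tendsto (fun ρ : ℝ => f 0 / ρ) atTop (𝓝 0))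
  · refine tendsto_nhds_unique (hlim _) ?_
    have hscale := ((hlim x).comp (tendsto_id.atTop_mul_const hc)).const_mul c
    refine hscale.congr fun ρ => ?_
    simp only [Function.comp_apply, id_eq, mul_smul]
    field_simp

lemma exists_seminorm_tendsto_of_almost_subadditive {f : E → ℝ} {K : ℝ≥0}
    (hf : LipschitzWith K f) {C : ℝ} (hadd : ∀ x y, f (x + y) ≤ f x + f y + C)
    (hneg : ∀ x, f (-x) ≤ f x + C) :
    ∃ N : Seminorm ℝ E, ∀ x, Tendsto (fun ρ : ℝ => f (ρ • x) / ρ) atTop (𝓝 (N x)) := by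
  have hray (x : E) : ∃ L, Tendsto (fun ρ : ℝ => f (ρ • x) / ρ) atTop (𝓝 L) :=
    exists_tendsto_div_atTop_of_almost_subadditive
      (hf.comp (ContinuousLinearMap.toSpanSingleton ℝ x).lipschitz)
      fun s t => by simpa [add_smul] using hadd (s • x) (t • x)
  choose N hN using hray
  have herror (a : ℝ → ℝ) {L : ℝ} (ha : Tendsto a atTop (𝓝 L)) :
      Tendsto (fun ρ => a ρ + C / ρ) atTop (𝓝 L) := by
    simpa using ha.add (tendsto_const_nhds.div_atTop tendsto_id :
      Tendsto (fun ρ : ℝ => C / ρ) atTop (𝓝 0))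
  have hN_add (x y : E) : N (x + y) ≤ N x + N y := by
    refine le_of_tendsto_of_tendsto (hN _) (herror _ ((hN x).add (hN y))) ?_
    filter_upwards [eventually_gt_atTop 0] with ρ hρ
    rw [← add_div, ← add_div, smul_add]
    gcongr
    exact hadd _ _
  have hN_neg_le (x : E) : N (-x) ≤ N x := by
    refine le_of_tendsto_of_tendsto (hN _) (herror _ (hN x)) ?_
    filter_upwards [eventually_gt_atTop 0] with ρ hρ
    rw [← add_div, smul_neg]
    gcongr
    exact hneg _
  have hN_neg (x : E) : N (-x) = N x :=
    (hN_neg_le x).antisymm (by simpa using hN_neg_le (-x))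
  refine ⟨Seminorm.of N hN_add fun c x => ?_, hN⟩
  rcases le_total 0 c with hc | hc
  · rw [asymptoticLimit_smul_of_nonneg hN hc, Real.norm_of_nonneg hc]
  · rw [← hN_neg, ← neg_smul, asymptoticLimit_smul_of_nonneg hN (neg_nonneg.2 hc),
      Real.norm_of_nonpos hc]

end StableSeminorm

section UniformConvergence

lemma exists_antitone_dist_le_of_tendstoUniformlyOn {A X Y : Type*} [Preorder A]
    [PseudoMetricSpace Y] {F : A → X → Y} {f : X → Y} {s : Set X}
    (hF : TendstoUniformlyOn F f atTop s) {M : ℝ} (hM : ∀ a, ∀ x ∈ s, dist (f x) (F a x) ≤ M) :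
    ∃ η : A → ℝ, (∀ a, 0 ≤ η a) ∧ Antitone η ∧ Tendsto η atTop (𝓝 0) ∧
      ∀ a, ∀ x ∈ s, dist (f x) (F a x) ≤ η a := by
  let e (a : A) (p : Ici a × s) : ℝ := dist (f p.2) (F p.1 p.2)
  have hbdd (a : A) : BddAbove (range (e a)) :=
    ⟨M, by rintro _ ⟨p, rfl⟩; exact hM _ _ p.2.2⟩
  have he_nonneg (a : A) : 0 ≤ ⨆ p, e a p := Real.iSup_nonneg fun _ => dist_nonneg
  refine ⟨fun a => ⨆ p, e a p, he_nonneg, fun a b hab => ?_, ?_, fun a x hx => ?_⟩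
  · exact Real.iSup_le (fun p => le_ciSup (hbdd a) (⟨p.1, hab.trans p.1.2⟩, p.2)) (he_nonneg a)
  · refine Metric.tendsto_nhds.2 fun ε hε => ?_
    have htail := Metric.tendstoUniformlyOn_iff.1 hF (ε / 2) (half_pos hε)
    filter_upwards [eventually_forall_ge_atTop.2 htail] with a ha
    rw [Real.dist_0_eq_abs, abs_of_nonneg (he_nonneg a)]
    exact (Real.iSup_le (fun p => (ha _ p.1.2 _ p.2.2).le) (half_pos hε).le).trans_lt
      (half_lt_self hε)
  · exact le_ciSup (hbdd a) (⟨a, le_rfl⟩, ⟨x, hx⟩)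

lemma tendstoLocallyUniformly_of_lipschitzWith {A X Y : Type*} [PseudoMetricSpace X]
    [PseudoMetricSpace Y] {l : Filter A} {F : A → X → Y} {f : X → Y} {K : ℝ≥0}
    (hF : ∀ a, LipschitzWith K (F a)) (hf : LipschitzWith K f)
    (hlim : ∀ x, Tendsto (fun a => F a x) l (𝓝 (f x))) : TendstoLocallyUniformly F f l := by
  refine Metric.tendstoLocallyUniformly_iff.2 fun ε hε x => ?_
  have hδ : 0 < ε / (3 * (K + 1)) := by positivity
  refine ⟨Metric.ball x (ε / (3 * (K + 1))), Metric.ball_mem_nhds x hδ, ?_⟩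
  filter_upwards [Metric.tendsto_nhds.1 (hlim x) (ε / 3) (by positivity)] with a ha y hy
  have hsmall : K * dist y x ≤ ε / 3 := by
    rw [Metric.mem_ball, lt_div_iff₀ (by positivity)] at hy
    nlinarith [dist_nonneg (x := y) (y := x), K.2]
  have h1 := (hf.dist_le_mul y x).trans hsmall
  have h2 := ((hF a).dist_le_mul y x).trans hsmall
  rw [dist_comm] at ha h2
  linarith [dist_triangle4 (f y) (f x) (F a x) (F a y)]

lemma tendsto_ite_le {A : Type*} {l : Filter A} {c u : A → ℝ} {c₀ u₀ R : ℝ}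
    (hc : Tendsto c l (𝓝 c₀)) (hu : Tendsto u l (𝓝 u₀)) (hR : c₀ ≠ R) :
    Tendsto (fun a => if c a ≤ R then u a else 0) l (𝓝 (if c₀ ≤ R then u₀ else 0)) := by
  rcases hR.lt_or_gt with h | h
  · rw [if_pos h.le]
    refine hu.congr' ?_
    filter_upwards [hc.eventually_lt_const h] with a ha using (if_pos ha.le).symm
  · rw [if_neg h.not_ge]
    refine tendsto_const_nhds.congr' ?_
    filter_upwards [hc.eventually_const_lt h] with a ha using (if_neg ha.not_ge).symm

end UniformConvergence

section RadialRetract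

variable {E : Type*} [AddCommGroup E] [Module ℝ E] (p : Seminorm ℝ E) {r : ℝ}

/-- The radial retraction of a real vector space onto the closed ball of radius `r` of a
seminorm `p`. -/
noncomputable def radialRetract (r : ℝ) (x : E) : E := (r / max r (p x)) • x

lemma radialRetract_of_le (hr : 0 < r) {x : E} (hx : p x ≤ r) : radialRetract p r x = x := by
  rw [radialRetract, max_eq_left hx, div_self hr.ne', one_smul]

lemma map_radialRetract (hr : 0 ≤ r) (x : E) : p (radialRetract p r x) = min r (p x) := by
  rw [radialRetract, map_smul_eq_mul,
    Real.norm_of_nonneg (div_nonneg hr (hr.trans (le_max_left _ _)))]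
  rcases le_total (p x) r with h | h
  · rw [max_eq_left h, min_eq_right h]
    rcases hr.eq_or_lt with rfl | hr
    · simp [h.antisymm (apply_nonneg p x)]
    · rw [div_self hr.ne', one_mul]
  · rw [max_eq_right h, min_eq_left h]
    rcases hr.eq_or_lt with rfl | hr
    · simp
    · exact div_mul_cancel₀ r (hr.trans_le h).ne'

lemma map_sub_radialRetract (hr : 0 ≤ r) (x : E) :
    p (x - radialRetract p r x) = p x - min r (p x) := by
  have hle : r / max r (p x) ≤ 1 := div_le_one_of_le₀ (le_max_left _ _) (hr.trans (le_max_left _ _))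
  have hfactor : x - radialRetract p r x = (1 - r / max r (p x)) • x := by
    rw [radialRetract, sub_smul, one_smul]
  have hmap := map_radialRetract p hr x
  rw [radialRetract, map_smul_eq_mul,
    Real.norm_of_nonneg (div_nonneg hr (hr.trans (le_max_left _ _)))] at hmap
  rw [hfactor, map_smul_eq_mul, Real.norm_of_nonneg (sub_nonneg.2 hle), sub_mul, one_mul, hmap]

lemma map_sub_radialRetract_le (hr : 0 ≤ r) {η : ℝ} (hη : 0 ≤ η) {x : E} (hx : p x ≤ r + η) :
    p (x - radialRetract p r x) ≤ η := by
  rw [map_sub_radialRetract p hr]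
  rcases min_choice r (p x) with h | h <;> rw [h] <;> linarith

lemma abs_sub_map_radialRetract_sub_le (hr : 0 ≤ r) {η : ℝ} (hη : 0 ≤ η) {x y : E}
    (hx : p x ≤ r + η) (hy : p y ≤ r + η) :
    |p (x - y) - p (radialRetract p r x - radialRetract p r y)| ≤ 2 * η := by
  have hsub : x - y - (radialRetract p r x - radialRetract p r y) =
      (x - radialRetract p r x) - (y - radialRetract p r y) := by abel
  refine (abs_sub_map_le_sub p _ _).trans ?_
  rw [hsub]
  linarith [map_sub_le_add p (x - radialRetract p r x) (y - radialRetract p r y),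
    map_sub_radialRetract_le p hr hη hx, map_sub_radialRetract_le p hr hη hy]

lemma continuous_radialRetract [TopologicalSpace E] [ContinuousSMul ℝ E] (hp : Continuous p)
    (hr : 0 < r) : Continuous (radialRetract p r) :=
  (continuous_const.div (continuous_const.max hp)
    fun _ => (hr.trans_le (le_max_left _ _)).ne').smul continuous_id

end RadialRetract

lemma ae_seminorm_ne {E : Type*} [NormedAddCommGroup E] [NormedSpace ℝ E] [FiniteDimensional ℝ E]
    [MeasurableSpace E] [BorelSpace E] (ν : Measure E) [ν.IsAddHaarMeasure] (p : Seminorm ℝ E)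
    {r : ℝ} (hr : 0 < r) : ∀ᵐ x ∂ν, p x ≠ r := by
  have hconvex : Convex ℝ {x | p x ≤ r} := by simpa using p.convexOn.convex_le r
  refine measure_mono_null (fun x hx => ?_) (hconvex.addHaar_frontier ν)
  have hxr : p x = r := not_not.1 hx
  refine ⟨subset_closure hxr.le, fun hint => ?_⟩
  have hray : Tendsto (fun t : ℝ => t • x) (𝓝[>] 1) (𝓝 x) := by
    simpa using ((continuous_id.smul continuous_const).tendsto (1 : ℝ)).mono_left
      (nhdsWithin_le_nhds (s := Ioi 1)) (f := fun t : ℝ => t • x)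
  obtain ⟨t, htx, ht : (1 : ℝ) < t⟩ :=
    ((hray.eventually (mem_interior_iff_mem_nhds.1 hint)).and self_mem_nhdsWithin).exists
  have htx : p (t • x) ≤ r := htx
  rw [map_smul_eq_mul, hxr, Real.norm_of_nonneg (zero_le_one.trans ht.le)] at htx
  exact htx.not_gt (lt_mul_of_one_lt_left hr ht)

section RescaleDist

variable {E : Type*} [NormedAddCommGroup E] [NormedSpace ℝ E]

/-- The distance `d` seen at scale `ρ`: `d_ρ(x, y) = d(ρ x, ρ y) / ρ`. -/
noncomputable def rescaleDist (d : E → E → ℝ) (ρ : ℝ) (x y : E) : ℝ := d (ρ • x) (ρ • y) / ρ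

lemma lipschitzWith_rescaleDist {d : E → E → ℝ} {K : ℝ≥0}
    (hd : LipschitzWith K (Function.uncurry d)) {ρ : ℝ} (hρ : 0 < ρ) :
    LipschitzWith K (Function.uncurry (rescaleDist d ρ)) := by
  refine LipschitzWith.of_dist_le_mul fun p q => ?_
  have hscale := hd.dist_le_mul (ρ • p) (ρ • q)
  rw [dist_smul₀, Real.norm_of_nonneg hρ.le, Real.dist_eq] at hscale
  rw [Real.dist_eq, Function.uncurry, Function.uncurry, rescaleDist, rescaleDist, ← sub_div,
    abs_div, abs_of_pos hρ, div_le_iff₀ hρ]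
  exact hscale.trans_eq (by ring)

lemma tendsto_rescaleDist {d : E → E → ℝ} {C : ℝ}
    (hC : ∀ x y z, |d (x + z) (y + z) - d x y| ≤ C) {N : Seminorm ℝ E}
    (hN : ∀ x, Tendsto (fun ρ : ℝ => d 0 (ρ • x) / ρ) atTop (𝓝 (N x))) (x y : E) :
    Tendsto (fun ρ => rescaleDist d ρ x y) atTop (𝓝 (N (x - y))) := by
  rw [map_sub_rev]
  refine (hN (y - x)).congr_dist (squeeze_zero_norm' ?_ (tendsto_const_nhds.div_atTop tendsto_id :
    Tendsto (fun ρ : ℝ => C / ρ) atTop (𝓝 0)))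
  filter_upwards [eventually_gt_atTop 0] with ρ hρ
  have htranslate := hC 0 (ρ • (y - x)) (ρ • x)
  rw [zero_add, ← smul_add, sub_add_cancel] at htranslate
  rw [Real.norm_of_nonneg dist_nonneg, dist_comm, Real.dist_eq, rescaleDist, ← sub_div,
    abs_div, abs_of_pos hρ]
  gcongr

end RescaleDist

namespace IsBilipDist

variable {n : ℕ} {d : Eucl n → Eucl n → ℝ}

lemma abs_sub_le (hd : IsBilipDist d) (x y x' y' : Eucl n) :
    |d x y - d x' y'| ≤ d x x' + d y y' := by
  rw [abs_sub_le_iff]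
  constructor
  · linarith [hd.triangle x x' y, hd.triangle x' y' y, hd.comm y y']
  · linarith [hd.triangle x' x y', hd.triangle x y y', hd.comm x x']

lemma exists_lipschitzWith_uncurry (hd : IsBilipDist d) :
    ∃ K, LipschitzWith K (Function.uncurry d) := by
  obtain ⟨_, β, _, hβ, h⟩ := hd.bilip
  refine ⟨(2 * β).toNNReal, LipschitzWith.of_dist_le_mul fun p q => ?_⟩
  have hfst : β * ‖p.1 - q.1‖ ≤ β * dist p q := by
    gcongr
    exact (dist_eq_norm _ _).symm.trans_le (le_max_left _ _)
  have hsnd : β * ‖p.2 - q.2‖ ≤ β * dist p q := by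
    gcongr
    exact (dist_eq_norm _ _).symm.trans_le (le_max_right _ _)
  rw [Real.coe_toNNReal _ (by positivity), Real.dist_eq]
  exact (hd.abs_sub_le _ _ _ _).trans (by linarith [(h p.1 q.1).2, (h p.2 q.2).2])

protected lemma rescaleDist (hd : IsBilipDist d) {ρ : ℝ} (hρ : 0 < ρ) :
    IsBilipDist (rescaleDist d ρ) := by
  obtain ⟨α, β, hα, hβ, h⟩ := hd.bilip
  refine ⟨fun x => ?_, fun x y => ?_, fun x y z => ?_, α, β, hα, hβ, fun x y => ?_⟩
  · rw [rescaleDist, hd.self, zero_div]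
  · rw [rescaleDist, hd.comm, rescaleDist]
  · rw [rescaleDist, rescaleDist, rescaleDist, ← add_div]
    gcongr
    exact hd.triangle _ _ _
  · rw [rescaleDist, le_div_iff₀ hρ, div_le_iff₀ hρ]
    have := h (ρ • x) (ρ • y)
    rw [← smul_sub, norm_smul, Real.norm_of_nonneg hρ.le] at this
    constructor <;> linarith [this.1, this.2]

lemma exists_norm_le_of_rescaleDist_le (hd : IsBilipDist d) (R : ℝ) :
    ∃ r, ∀ ρ > 0, ∀ x, rescaleDist d ρ 0 x ≤ R → ‖x‖ ≤ r := by
  obtain ⟨α, _, hα, _, h⟩ := hd.bilip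
  refine ⟨R / α, fun ρ hρ x hx => ?_⟩
  have hlower := (h (ρ • 0) (ρ • x)).1
  rw [rescaleDist, div_le_iff₀ hρ] at hx
  rw [← smul_sub, zero_sub, norm_smul, norm_neg, Real.norm_of_nonneg hρ.le] at hlower
  rw [le_div_iff₀ hα]
  nlinarith

lemma exists_abs_sub_le_of_periodic (hd : IsBilipDist d) {ι : Type*} [Finite ι]
    (b : Module.Basis ι ℝ (Eucl n))
    (hdb : ∀ v ∈ Submodule.span ℤ (range b), ∀ x y, d (x + v) (y + v) = d x y) :
    ∃ C, ∀ x y z, |d (x + z) (y + z) - d x y| ≤ C := by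
  cases nonempty_fintype ι
  obtain ⟨_, β, _, hβ, h⟩ := hd.bilip
  refine ⟨2 * (β * ∑ i, ‖b i‖), fun x y z => ?_⟩
  have hfract (x : Eucl n) : d (x + ZSpan.fract b z) x ≤ β * ∑ i, ‖b i‖ := by
    refine (h _ _).2.trans ?_
    rw [add_sub_cancel_left]
    gcongr
    exact ZSpan.norm_fract_le b z
  have hz : z = ZSpan.fract b z + ZSpan.floor b z := (sub_add_cancel _ _).symm
  conv_lhs => rw [hz, ← add_assoc, ← add_assoc, hdb _ (ZSpan.floor b z).2]
  linarith [hd.abs_sub_le (x + ZSpan.fract b z) (y + ZSpan.fract b z) x y, hfract x, hfract y]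

lemma exists_vecNorm_tendsto (hd : IsBilipDist d) {C : ℝ}
    (hC : ∀ x y z, |d (x + z) (y + z) - d x y| ≤ C) :
    ∃ N : VecNorm n, ∀ x, Tendsto (fun ρ : ℝ => d 0 (ρ • x) / ρ) atTop (𝓝 (N x)) := by
  obtain ⟨K, hK⟩ := hd.exists_lipschitzWith_uncurry
  obtain ⟨N, hN⟩ := exists_seminorm_tendsto_of_almost_subadditive
    (hK.comp (LipschitzWith.prodMk_left (0 : Eucl n))) (C := C)
    (fun x y => by
      have htranslate := (abs_le.1 (hC 0 y x)).2
      rw [zero_add, add_comm y] at htranslate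
      simp only [Function.comp_apply, Function.uncurry]
      linarith [hd.triangle 0 x (x + y)])
    (fun x => by
      have htranslate := (abs_le.1 (hC 0 (-x) x)).1
      rw [zero_add, neg_add_cancel, hd.comm x] at htranslate
      simp only [Function.comp_apply, Function.uncurry]
      linarith)
  refine ⟨⟨N, fun x hx => norm_le_zero_iff.1 ?_⟩, hN⟩
  obtain ⟨α, _, hα, _, h⟩ := hd.bilip
  have hlower : α * ‖x‖ ≤ N x := by
    refine ge_of_tendsto (hN x) ?_
    filter_upwards [eventually_gt_atTop 0] with ρ hρ
    have := (h 0 (ρ • x)).1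
    rw [zero_sub, norm_neg, norm_smul, Real.norm_of_nonneg hρ.le] at this
    exact (le_div_iff₀ hρ).2 (by simpa [mul_left_comm, mul_comm, mul_assoc] using this)
  exact nonpos_of_mul_nonpos_right (hlower.trans_eq hx) hα

lemma tendstoLocallyUniformly_rescaleDist (hd : IsBilipDist d) {C : ℝ}
    (hC : ∀ x y z, |d (x + z) (y + z) - d x y| ≤ C) {N : VecNorm n}
    (hN : ∀ x, Tendsto (fun ρ : ℝ => d 0 (ρ • x) / ρ) atTop (𝓝 (N x))) :
    TendstoLocallyUniformly (fun ρ : Ioi (0 : ℝ) => Function.uncurry (rescaleDist d ρ))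
      (fun p => N (p.1 - p.2)) atTop := by
  obtain ⟨K, hK⟩ := hd.exists_lipschitzWith_uncurry
  obtain ⟨L, hL⟩ := N.isBilipDist.exists_lipschitzWith_uncurry
  exact tendstoLocallyUniformly_of_lipschitzWith (K := max K L)
    (fun ρ => (lipschitzWith_rescaleDist hK ρ.2).weaken (le_max_left _ _))
    (hL.weaken (le_max_right _ _))
    fun p => tendsto_comp_val_Ioi_atTop.2 (tendsto_rescaleDist hC hN p.1 p.2)

lemma exists_antitone_abs_rescaleDist_sub_le (hd : IsBilipDist d) {C : ℝ}
    (hC : ∀ x y z, |d (x + z) (y + z) - d x y| ≤ C) {N : VecNorm n}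
    (hN : ∀ x, Tendsto (fun ρ : ℝ => d 0 (ρ • x) / ρ) atTop (𝓝 (N x))) {S : Set (Eucl n)}
    (hS : IsCompact S) :
    ∃ η : Ioi (0 : ℝ) → ℝ, (∀ ρ, 0 < η ρ) ∧ Antitone η ∧ Tendsto η atTop (𝓝 0) ∧
      ∀ ρ : Ioi (0 : ℝ), ∀ x ∈ S, ∀ y ∈ S, |N (x - y) - rescaleDist d ρ x y| ≤ η ρ := by
  obtain ⟨K, hK⟩ := hd.exists_lipschitzWith_uncurry
  obtain ⟨L, hL⟩ := N.isBilipDist.exists_lipschitzWith_uncurry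
  obtain ⟨r, hr⟩ := (hS.prod hS).isBounded.subset_closedBall (0 : Eucl n × Eucl n)
  have hbound (ρ : Ioi (0 : ℝ)) (p) (hp : p ∈ S ×ˢ S) :
      dist (N (p.1 - p.2)) (Function.uncurry (rescaleDist d ρ) p) ≤ L * r + K * r := by
    have h1 := hL.dist_le_mul_of_le (hr hp)
    have h2 := (lipschitzWith_rescaleDist hK ρ.2).dist_le_mul_of_le (hr hp)
    simp only [Function.uncurry, Prod.fst_zero, Prod.snd_zero, N.isBilipDist.self,
      (hd.rescaleDist ρ.2).self, Real.dist_0_eq_abs] at h1 h2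
    exact (abs_sub _ _).trans (add_le_add h1 h2)
  obtain ⟨η, hη_nonneg, hη_anti, hη_lim, hη⟩ := exists_antitone_dist_le_of_tendstoUniformlyOn
    (tendstoLocallyUniformly_iff_forall_isCompact.1
      (hd.tendstoLocallyUniformly_rescaleDist hC hN) _ (hS.prod hS)) hbound
  have hinv_pos (ρ : Ioi (0 : ℝ)) : 0 < (ρ : ℝ)⁻¹ := inv_pos.2 ρ.2
  refine ⟨fun ρ => η ρ + (ρ : ℝ)⁻¹, fun ρ => add_pos_of_nonneg_of_pos (hη_nonneg ρ) (hinv_pos ρ),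
    fun ρ ρ' h => add_le_add (hη_anti h) (inv_anti₀ ρ.2 h), ?_, fun ρ x hx y hy => ?_⟩
  · simpa using hη_lim.add (tendsto_comp_val_Ioi_atTop.2 tendsto_inv_atTop_zero)
  · exact (hη ρ (x, y) ⟨hx, hy⟩).trans (le_add_of_nonneg_right (hinv_pos ρ).le)

end IsBilipDist

namespace VecNorm

variable {n : ℕ} (N : VecNorm n) (μ : Measure (Eucl n)) [IsFiniteMeasureOnCompacts μ] {R : ℝ}

lemma continuous : Continuous N.toSeminorm :=
  N.toSeminorm.convexOn.locallyLipschitz.continuous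

/-- The radial retraction of `ℝⁿ` onto the ball of radius `R` of the norm `N`, with values in the
measured metric space `N.closedBall μ R`. -/
noncomputable def toClosedBall (hR : 0 ≤ R) (x : Eucl n) : N.closedBall μ R :=
  ⟨radialRetract N.toSeminorm R x, by
    simp only [zero_sub, map_neg_eq_map, map_radialRetract _ hR, min_le_left]⟩

variable {μ} in
lemma toClosedBall_coe (hR : 0 < R) (x : {x // N (0 - x) ≤ R}) :
    N.toClosedBall μ hR.le x.1 = x :=
  Subtype.ext (radialRetract_of_le N.toSeminorm hR (by simpa using x.2))

lemma continuous_toClosedBall (hR : 0 < R) : Continuous (N.toClosedBall μ hR.le) :=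
  (continuous_radialRetract N.toSeminorm N.continuous hR).subtype_mk _

section HausdorffApprox

variable {N} {d : Eucl n → Eucl n → ℝ} (hd : IsBilipDist d) {η : ℝ}
include hd

lemma exists_mem_closedBall_map_sub_le (hR : 0 < R) (hη : 0 ≤ η) {y : Eucl n} (hy : N y ≤ R)
    (hclose : ∀ x, N x ≤ R → |N (0 - x) - d 0 x| ≤ η) :
    ∃ x, d 0 x ≤ R ∧ N x ≤ R ∧ N (x - y) ≤ η := by
  have hr : 0 ≤ max 0 (R - η) := le_max_left _ _
  have hyr : N y ≤ max 0 (R - η) + η := by linarith [le_max_right 0 (R - η)]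
  have hx : N (radialRetract N.toSeminorm (max 0 (R - η)) y) ≤ max 0 (R - η) :=
    (map_radialRetract _ hr y).trans_le (min_le_left _ _)
  have hxR := hx.trans (max_le hR.le (sub_le_self R hη))
  refine ⟨_, ?_, hxR, (map_sub_rev _ _ _).trans_le (map_sub_radialRetract_le _ hr hη hyr)⟩
  rcases le_total 0 (R - η) with h | h
  · rw [max_eq_right h] at hx hxR ⊢
    have := (abs_le.1 (hclose _ hxR)).1
    rw [zero_sub, map_neg_eq_map] at this
    linarith
  · rw [max_eq_left h] at hx ⊢
    rw [N.eq_zero_of_map_eq_zero _ (hx.antisymm (apply_nonneg _ _)), hd.self]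
    exact hR.le

lemma isHausdorffApprox_toClosedBall (ν : Measure (Eucl n)) [IsFiniteMeasureOnCompacts ν]
    (hR : 0 < R) (hη : 0 < η) {S : Set (Eucl n)} (h0 : 0 ∈ S) (hdS : {x | d 0 x ≤ R} ⊆ S)
    (hNS : {x | N x ≤ R} ⊆ S) (hclose : ∀ x ∈ S, ∀ y ∈ S, |N (x - y) - d x y| ≤ η) :
    IsHausdorffApprox (3 * η) fun x : hd.closedBall ν R => N.toClosedBall μ hR.le x.1 := by
  have hN_le {x : Eucl n} (hx : d 0 x ≤ R) : N x ≤ R + η := by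
    have := (abs_le.1 (hclose 0 h0 x (hdS hx))).2
    rw [zero_sub, map_neg_eq_map] at this
    linarith
  refine ⟨eq_univ_of_forall fun y => ?_, fun x y => ?_⟩
  · have hy : N y.1 ≤ R := by simpa using y.2
    obtain ⟨x, hdx, hNx, hxy⟩ := exists_mem_closedBall_map_sub_le hd hR hη.le hy
      fun x hx => hclose 0 h0 x (hNS hx)
    refine Metric.mem_thickening_iff.2 ⟨_, ⟨⟨x, hdx⟩, rfl⟩, ?_⟩
    change N (y.1 - radialRetract N.toSeminorm R x) < 3 * η
    rw [radialRetract_of_le _ hR hNx, map_sub_rev]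
    linarith
  · change |d x.1 y.1 - N (radialRetract N.toSeminorm R x.1 - radialRetract N.toSeminorm R y.1)| ≤ _
    have hdN := hclose x.1 (hdS x.2) y.1 (hdS y.2)
    have hret := abs_sub_map_radialRetract_sub_le N.toSeminorm hR.le hη.le (hN_le x.2) (hN_le y.2)
    rw [abs_sub_comm] at hdN
    linarith [_root_.abs_sub_le (d x.1 y.1) (N (x.1 - y.1))
      (N (radialRetract N.toSeminorm R x.1 - radialRetract N.toSeminorm R y.1))]

end HausdorffApprox

end VecNorm

lemma IsBilipDist.integral_closedBall {n : ℕ} {d : Eucl n → Eucl n → ℝ} (hd : IsBilipDist d)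
    (μ : Measure (Eucl n)) [IsFiniteMeasureOnCompacts μ] (R : ℝ) (f : Eucl n → ℝ) :
    ∫ x, f x.1 ∂(hd.closedBall μ R).measure = ∫ x, (if d 0 x ≤ R then f x else 0) ∂μ := by
  have hball := (hd.isCompact_ball R).measurableSet
  exact (integral_subtype_comap hball f).trans (integral_indicator hball).symm

lemma VecNorm.integral_closedBall {n : ℕ} (N : VecNorm n) (μ : Measure (Eucl n))
    [IsFiniteMeasureOnCompacts μ] {R : ℝ} (hR : 0 < R) (u : N.closedBall μ R → ℝ) :
    ∫ y, u y ∂(N.closedBall μ R).measure =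
      ∫ x, (if N (0 - x) ≤ R then u (N.toClosedBall μ hR.le x) else 0) ∂μ := by
  rw [← N.isBilipDist.integral_closedBall]
  exact integral_congr_ae (.of_forall fun y => congrArg u (N.toClosedBall_coe hR y).symm)

lemma isFiniteMeasureOnCompacts_comap {X Y : Type*} [TopologicalSpace X] [TopologicalSpace Y]
    [T2Space X] [MeasurableSpace X] [OpensMeasurableSpace X] [MeasurableSpace Y] {f : X → Y}
    (hf : Continuous f) (μ : Measure Y) [IsFiniteMeasureOnCompacts μ] :
    IsFiniteMeasureOnCompacts (μ.comap f) := by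
  by_cases h : f.Injective ∧ ∀ s, MeasurableSet s → NullMeasurableSet (f '' s) μ
  · refine ⟨fun K hK => ?_⟩
    rw [Measure.comap_apply₀ f μ h.1 h.2 hK.measurableSet.nullMeasurableSet]
    exact (hK.image hf).measure_lt_top
  · rw [Measure.comap_undef h]
    infer_instance

section Averaging

variable {E : Type*} [NormedAddCommGroup E] [NormedSpace ℝ E] {ι : Type*} (b : Module.Basis ι ℝ E)

section Floor

variable [Fintype ι]

lemma zspanFloor_add_of_mem_fundamentalDomain {v x : E} (hv : v ∈ Submodule.span ℤ (range b))
    (hx : x ∈ ZSpan.fundamentalDomain b) : (ZSpan.floor b (v + x) : E) = v := by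
  have hfract : ZSpan.fract b (v + x) = x :=
    (ZSpan.fract_zSpan_add b x hv).trans (ZSpan.fract_eq_self.2 hx)
  rw [ZSpan.fract_apply] at hfract
  exact (add_right_cancel (sub_eq_iff_eq_add'.1 hfract)).symm

/-- The point at position `s` in the cell of `x`, for the tiling of `E` by the translates under
`ρ⁻¹ Λ` of the rescaled fundamental domain, where `Λ` is the lattice spanned by `b`. -/
noncomputable def cellPoint (ρ : ℝ) (p : E × E) : E := ρ⁻¹ • (ZSpan.floor b (ρ • p.1) + p.2)

lemma norm_cellPoint_sub_le {ρ : ℝ} (hρ : 0 < ρ) (p : E × E) :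
    ‖cellPoint b ρ p - p.1‖ ≤ (‖p.2‖ + ∑ i, ‖b i‖) / ρ := by
  have hsub : cellPoint b ρ p - p.1 = ρ⁻¹ • (p.2 - ZSpan.fract b (ρ • p.1)) := by
    rw [cellPoint, ZSpan.fract_apply, ← sub_add, sub_add_eq_add_sub, smul_sub,
      inv_smul_smul₀ hρ.ne', add_comm]
  rw [hsub, norm_smul, norm_inv, Real.norm_of_nonneg hρ.le, ← div_eq_inv_mul]
  gcongr
  exact (norm_sub_le _ _).trans (by gcongr; exact ZSpan.norm_fract_le b _)

lemma tendsto_cellPoint (p : E × E) : Tendsto (fun ρ => cellPoint b ρ p) atTop (𝓝 p.1) := by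
  refine tendsto_iff_norm_sub_tendsto_zero.2 (squeeze_zero' (.of_forall fun _ => norm_nonneg _) ?_
    (tendsto_const_nhds.div_atTop tendsto_id :
      Tendsto (fun ρ : ℝ => (‖p.2‖ + ∑ i, ‖b i‖) / ρ) atTop (𝓝 0)))
  filter_upwards [eventually_gt_atTop 0] with ρ hρ using norm_cellPoint_sub_le b hρ p

end Floor

variable [MeasurableSpace E]

lemma measure_fundamentalDomain_ne_top [Finite ι] (μ : Measure E) [IsFiniteMeasureOnCompacts μ] :
    μ (ZSpan.fundamentalDomain b) ≠ ⊤ :=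
  have := b.finiteDimensional_of_finite
  have := FiniteDimensional.proper_real E
  (ZSpan.fundamentalDomain_isBounded b).measure_lt_top.ne

variable [BorelSpace E]

/-- The measure `μ` seen at scale `ρ`: the pull-back of `μ` by `x ↦ ρ x`, divided by `ρ ^ dim E`.
With `Measure.comap` it is finite on compact sets for every `ρ`. -/
noncomputable def rescaleMeasure (μ : Measure E) (ρ : ℝ) : Measure E :=
  ENNReal.ofReal (ρ ^ Module.finrank ℝ E)⁻¹ • μ.comap (ρ • ·)

instance (μ : Measure E) [IsFiniteMeasureOnCompacts μ] (ρ : ℝ) :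
    IsFiniteMeasureOnCompacts (rescaleMeasure μ ρ) :=
  have := isFiniteMeasureOnCompacts_comap (continuous_const_smul ρ) μ
  .smul _ ENNReal.ofReal_ne_top

/-- The multiple of the Lebesgue measure `ν` that gives to the fundamental domain of the lattice
spanned by `b` the same mass as `μ`. -/
noncomputable def averagedMeasure (ν μ : Measure E) : Measure E :=
  (μ (ZSpan.fundamentalDomain b) / ν (ZSpan.fundamentalDomain b)) • ν

instance [Finite ι] (ν μ : Measure E) [ν.IsAddHaarMeasure] [IsFiniteMeasureOnCompacts μ] :
    IsFiniteMeasureOnCompacts (averagedMeasure b ν μ) :=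
  .smul _ (ENNReal.div_ne_top (measure_fundamentalDomain_ne_top b μ)
    (ZSpan.measure_fundamentalDomain_ne_zero b))

variable [Fintype ι]

lemma measurable_zspanFloor : Measurable fun x => (ZSpan.floor b x : E) := by
  have := b.finiteDimensional_of_finite
  have hfloor : (fun x => (ZSpan.floor b x : E)) = fun x => ∑ i, (⌊b.coord i x⌋ : ℝ) • b i := by
    funext x
    simp [ZSpan.floor, ← Int.cast_smul_eq_zsmul ℝ]
  rw [hfloor]
  refine Finset.measurable_fun_sum _ fun i _ => Measurable.smul_const ?_ _
  have hcoord := (b.coord i).continuous_of_finiteDimensional.measurable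
  fun_prop

lemma map_zspanFloor_add (μ ν : Measure E) [SFinite μ] [SFinite ν]
    [VAddInvariantMeasure (Submodule.span ℤ (range b)).toAddSubgroup E μ]
    [VAddInvariantMeasure (Submodule.span ℤ (range b)).toAddSubgroup E ν] :
    (ν.prod (μ.restrict (ZSpan.fundamentalDomain b))).map
        (fun p : E × E => (ZSpan.floor b p.1 : E) + p.2) =
      ν (ZSpan.fundamentalDomain b) • μ := by
  have := b.finiteDimensional_of_finite
  have : Countable (Submodule.span ℤ (range b)).toAddSubgroup :=
    inferInstanceAs (Countable (Submodule.span ℤ (range b)))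
  have hmeas : Measurable fun p : E × E => (ZSpan.floor b p.1 : E) + p.2 :=
    ((measurable_zspanFloor b).comp measurable_fst).add measurable_snd
  ext s hs
  rw [Measure.map_apply hmeas hs, Measure.prod_apply (hmeas hs),
    (ZSpan.isAddFundamentalDomain' b ν).lintegral_eq_tsum', Measure.smul_apply, smul_eq_mul,
    (ZSpan.isAddFundamentalDomain' b μ).measure_eq_tsum, ← ENNReal.tsum_mul_left]
  refine tsum_congr fun v => ?_
  rw [mul_comm, ← setLIntegral_const]
  refine setLIntegral_congr_fun (ZSpan.fundamentalDomain_measurableSet b) fun x hx => ?_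
  have hfloor : (ZSpan.floor b (-v +ᵥ x) : E) = -v :=
    zspanFloor_add_of_mem_fundamentalDomain b (-v).2 hx
  simp only [preimage_preimage, hfloor]
  rw [Measure.restrict_apply (hs.preimage (measurable_const_add _))]
  congr 2
  ext y
  rw [mem_vadd_set_iff_neg_vadd_mem]
  rfl

lemma measurable_cellPoint (ρ : ℝ) : Measurable (cellPoint b ρ) := by
  have := b.finiteDimensional_of_finite
  exact (((measurable_zspanFloor b).comp (measurable_fst.const_smul ρ)).add
    measurable_snd).const_smul ρ⁻¹

lemma map_cellPoint (ν μ : Measure E) [ν.IsAddHaarMeasure] [SFinite μ]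
    [VAddInvariantMeasure (Submodule.span ℤ (range b)).toAddSubgroup E μ] {ρ : ℝ} (hρ : 0 < ρ) :
    (ν.prod (μ.restrict (ZSpan.fundamentalDomain b))).map (cellPoint b ρ) =
      ν (ZSpan.fundamentalDomain b) • rescaleMeasure μ ρ := by
  have := b.finiteDimensional_of_finite
  have hscale : (ν.prod (μ.restrict (ZSpan.fundamentalDomain b))).map (Prod.map (ρ • ·) id) =
      ENNReal.ofReal (ρ ^ Module.finrank ℝ E)⁻¹ •
        ν.prod (μ.restrict (ZSpan.fundamentalDomain b)) := by
    rw [← Measure.map_prod_map _ _ (measurable_const_smul ρ) measurable_id, Measure.map_id,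
      Measure.map_addHaar_smul ν hρ.ne', abs_of_pos (by positivity), Measure.prod_smul_left]
  have hcomap : μ.map (ρ⁻¹ • ·) = μ.comap (ρ • ·) :=
    (MeasurableEquiv.smul₀ ρ hρ.ne').map_symm
  have hfloor : Measurable fun p : E × E => (ZSpan.floor b p.1 : E) + p.2 :=
    ((measurable_zspanFloor b).comp measurable_fst).add measurable_snd
  have hcomp : cellPoint b ρ = (ρ⁻¹ • ·) ∘ (fun p : E × E => (ZSpan.floor b p.1 : E) + p.2) ∘
      Prod.map (ρ • ·) id := rfl
  rw [hcomp, ← Measure.map_map (measurable_const_smul _) (hfloor.comp (by fun_prop)),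
    ← Measure.map_map hfloor (by fun_prop), hscale, Measure.map_smul, map_zspanFloor_add,
    Measure.map_smul, Measure.map_smul, hcomap, smul_comm, rescaleMeasure]

end Averaging

section WeakLimit

variable {E ι G : Type*} [NormedAddCommGroup E] [NormedSpace ℝ E] [MeasurableSpace E]
  [BorelSpace E] (b : Module.Basis ι ℝ E) [NormedAddCommGroup G] [NormedSpace ℝ G]
  (ν μ : Measure E) [ν.IsAddHaarMeasure] [IsFiniteMeasureOnCompacts μ]

lemma integral_cellPoint [Fintype ι]
    [VAddInvariantMeasure (Submodule.span ℤ (range b)).toAddSubgroup E μ]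
    {ρ : ℝ} (hρ : 0 < ρ) {F : E → G} (hF : StronglyMeasurable F) :
    ∫ p, F (cellPoint b ρ p) ∂ν.prod (μ.restrict (ZSpan.fundamentalDomain b)) =
      ν.real (ZSpan.fundamentalDomain b) • ∫ x, F x ∂rescaleMeasure μ ρ := by
  have := b.finiteDimensional_of_finite
  have := FiniteDimensional.proper_real E
  rw [← integral_map (measurable_cellPoint b ρ).aemeasurable hF.aestronglyMeasurable,
    map_cellPoint b ν μ hρ, integral_smul_measure, measureReal_def]

lemma tendsto_integral_cellPoint [Fintype ι] {A : Type*} {l : Filter A}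
    [l.IsCountablyGenerated] {ρ : A → ℝ} (hρ : Tendsto ρ l atTop)
    {F : A → E → G} {f : E → G} {r M : ℝ}
    (hF : ∀ᶠ a in l, StronglyMeasurable (F a)) (hM : ∀ᶠ a in l, ∀ x, ‖F a x‖ ≤ M)
    (hr : ∀ᶠ a in l, ∀ x, F a x ≠ 0 → ‖x‖ ≤ r)
    (hlim : ∀ᵐ x ∂ν, Tendsto (Function.uncurry F) (l ×ˢ 𝓝 x) (𝓝 (f x))) :
    Tendsto (fun a => ∫ p, F a (cellPoint b (ρ a) p)
        ∂ν.prod (μ.restrict (ZSpan.fundamentalDomain b))) l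
      (𝓝 (∫ p, f p.1 ∂ν.prod (μ.restrict (ZSpan.fundamentalDomain b)))) := by
  have := b.finiteDimensional_of_finite
  have := FiniteDimensional.proper_real E
  have : IsFiniteMeasure (μ.restrict (ZSpan.fundamentalDomain b)) :=
    isFiniteMeasure_restrict.2 (measure_fundamentalDomain_ne_top b μ)
  let g : E → ℝ := (Metric.closedBall 0 (r + 2 * ∑ i, ‖b i‖)).indicator fun _ => M
  have hg : Integrable g ν := (integrable_indicator_iff measurableSet_closedBall).2
    (integrableOn_const measure_closedBall_lt_top.ne)
  refine tendsto_integral_filter_of_dominated_convergence (fun p => g p.1) ?_ ?_ (hg.comp_fst _) ?_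
  · filter_upwards [hF] with a ha
    exact (ha.comp_measurable (measurable_cellPoint b _)).aestronglyMeasurable
  · filter_upwards [hM, hr, hρ.eventually_ge_atTop 1] with a haM har ha
    have hD := ae_restrict_mem (μ := μ) (ZSpan.fundamentalDomain_measurableSet b)
    filter_upwards [Measure.quasiMeasurePreserving_snd.ae hD] with p hp
    by_cases hFp : F a (cellPoint b (ρ a) p) = 0
    · rw [hFp, norm_zero]
      exact indicator_nonneg (fun _ _ => (norm_nonneg _).trans (haM 0)) _
    · have hp_norm : ‖p.2‖ ≤ ∑ i, ‖b i‖ := by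
        rw [← ZSpan.fract_eq_self.2 hp]
        exact ZSpan.norm_fract_le b p.2
      have hcell : ‖cellPoint b (ρ a) p - p.1‖ ≤ 2 * ∑ i, ‖b i‖ :=
        (norm_cellPoint_sub_le b (by positivity) p).trans
          ((div_le_self (by positivity) ha).trans (by linarith))
      have hmem : p.1 ∈ Metric.closedBall 0 (r + 2 * ∑ i, ‖b i‖) := by
        rw [mem_closedBall_zero_iff]
        linarith [norm_le_norm_add_norm_sub (cellPoint b (ρ a) p) p.1, har _ hFp]
      exact (haM _).trans_eq (indicator_of_mem hmem fun _ => M).symm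
  · filter_upwards [Measure.quasiMeasurePreserving_fst.ae hlim] with p hp
    exact hp.comp (tendsto_id.prodMk ((tendsto_cellPoint b p).comp hρ))

theorem tendsto_integral_rescaleMeasure [Finite ι]
    [VAddInvariantMeasure (Submodule.span ℤ (range b)).toAddSubgroup E μ] {A : Type*}
    {l : Filter A} [l.IsCountablyGenerated] {ρ : A → ℝ} (hρ : Tendsto ρ l atTop) {F : A → E → G}
    {f : E → G} {r M : ℝ} (hF : ∀ᶠ a in l, StronglyMeasurable (F a))
    (hM : ∀ᶠ a in l, ∀ x, ‖F a x‖ ≤ M) (hr : ∀ᶠ a in l, ∀ x, F a x ≠ 0 → ‖x‖ ≤ r)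
    (hlim : ∀ᵐ x ∂ν, Tendsto (Function.uncurry F) (l ×ˢ 𝓝 x) (𝓝 (f x))) :
    Tendsto (fun a => ∫ x, F a x ∂rescaleMeasure μ (ρ a)) l
      (𝓝 (∫ x, f x ∂averagedMeasure b ν μ)) := by
  cases nonempty_fintype ι
  have := b.finiteDimensional_of_finite
  have := FiniteDimensional.proper_real E
  have hD : ν.real (ZSpan.fundamentalDomain b) ≠ 0 := ENNReal.toReal_ne_zero.2
    ⟨ZSpan.measure_fundamentalDomain_ne_zero b, measure_fundamentalDomain_ne_top b ν⟩
  have hcell := (tendsto_integral_cellPoint b ν μ hρ hF hM hr hlim).const_smul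
    (ν.real (ZSpan.fundamentalDomain b))⁻¹
  rw [integral_fun_fst, measureReal_restrict_apply_univ, smul_smul, ← div_eq_inv_mul] at hcell
  rw [averagedMeasure, integral_smul_measure, ENNReal.toReal_div]
  refine hcell.congr' ?_
  filter_upwards [hF, hρ.eventually_gt_atTop 0] with a ha hρa
  rw [integral_cellPoint b ν μ hρa ha, inv_smul_smul₀ hD]

end WeakLimit

lemma tendsto_uncurry_of_tendstoLocallyUniformly {A X Y : Type*} [TopologicalSpace X]
    [UniformSpace Y] {l : Filter A} {F : A → X → Y} {f : X → Y}
    (hF : TendstoLocallyUniformly F f l) {x : X} (hf : ContinuousAt f x) :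
    Tendsto (Function.uncurry F) (l ×ˢ 𝓝 x) (𝓝 (f x)) :=
  tendsto_comp_of_locally_uniform_limit (F := fun a : A × X => F a.1) hf tendsto_snd fun u hu =>
    let ⟨t, ht, h⟩ := hF u hu x
    ⟨t, ht, h.prod_inl _⟩

section RescaledBalls

variable {n : ℕ} {d : Eucl n → Eucl n → ℝ} {C : ℝ} {N : VecNorm n} {R : ℝ}

lemma tendsto_integral_rescaleMeasure_of_rescaleDist_le (hd : IsBilipDist d)
    (hC : ∀ x y z, |d (x + z) (y + z) - d x y| ≤ C)
    (hN : ∀ x, Tendsto (fun ρ : ℝ => d 0 (ρ • x) / ρ) atTop (𝓝 (N x))) {ι : Type*} [Finite ι]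
    (b : Module.Basis ι ℝ (Eucl n)) (μ : Measure (Eucl n)) [IsFiniteMeasureOnCompacts μ]
    [VAddInvariantMeasure (Submodule.span ℤ (range b)).toAddSubgroup (Eucl n) μ] (hR : 0 < R)
    {f : Eucl n → ℝ} (hf : Continuous f) {M : ℝ} (hM : ∀ x, |f x| ≤ M) :
    Tendsto (fun ρ : Ioi (0 : ℝ) =>
        ∫ x, (if rescaleDist d ρ 0 x ≤ R then f x else 0) ∂rescaleMeasure μ ρ) atTop
      (𝓝 (∫ x, (if N (0 - x) ≤ R then f x else 0) ∂averagedMeasure b volume μ)) := by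
  obtain ⟨r, hr⟩ := hd.exists_norm_le_of_rescaleDist_le R
  have hM0 : 0 ≤ M := (abs_nonneg _).trans (hM 0)
  refine tendsto_integral_rescaleMeasure b volume μ (r := r) (M := M)
    (tendsto_comp_val_Ioi_atTop.2 tendsto_id) (.of_forall fun ρ => ?_) (.of_forall fun ρ x => ?_)
    (.of_forall fun ρ x hx => ?_) ?_
  · exact hf.stronglyMeasurable.ite
      ((hd.rescaleDist ρ.2).isCompact_ball R).measurableSet stronglyMeasurable_const
  · split_ifs
    exacts [hM x, by simpa using hM0]
  · exact hr ρ ρ.2 x (ite_ne_right_iff.1 hx).1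
  · filter_upwards [ae_seminorm_ne volume N.toSeminorm hR] with x hx
    have hdist : Tendsto (fun p : Ioi (0 : ℝ) × Eucl n => rescaleDist d p.1 0 p.2)
        (atTop ×ˢ 𝓝 x) (𝓝 (N (0 - x))) :=
      tendsto_uncurry_of_tendstoLocallyUniformly
        ((hd.tendstoLocallyUniformly_rescaleDist hC hN).comp _ (Continuous.prodMk_right 0))
        (N.continuous.comp (continuous_const.sub continuous_id)).continuousAt
    exact tendsto_ite_le hdist ((hf.tendsto x).comp tendsto_snd)
      (by rwa [zero_sub, map_neg_eq_map])

lemma exists_antitone_isHausdorffApprox_toClosedBall (hd : IsBilipDist d)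
    (hC : ∀ x y z, |d (x + z) (y + z) - d x y| ≤ C)
    (hN : ∀ x, Tendsto (fun ρ : ℝ => d 0 (ρ • x) / ρ) atTop (𝓝 (N x)))
    (μ : Ioi (0 : ℝ) → Measure (Eucl n)) [∀ ρ, IsFiniteMeasureOnCompacts (μ ρ)]
    (ν : Measure (Eucl n)) [IsFiniteMeasureOnCompacts ν] (hR : 0 < R) :
    ∃ ε : Ioi (0 : ℝ) → ℝ, (∀ ρ, 0 < ε ρ) ∧ Antitone ε ∧ Tendsto ε atTop (𝓝 0) ∧
      ∀ ρ, IsHausdorffApprox (ε ρ) fun x : (hd.rescaleDist ρ.2).closedBall (μ ρ) R =>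
        N.toClosedBall ν hR.le x.1 := by
  obtain ⟨r, hr⟩ := hd.exists_norm_le_of_rescaleDist_le R
  have hS : IsCompact (Metric.closedBall 0 r ∪ {x | N (0 - x) ≤ R}) :=
    (isCompact_closedBall _ _).union (N.isBilipDist.isCompact_ball R)
  obtain ⟨η, hη_pos, hη_anti, hη_lim, hη⟩ := hd.exists_antitone_abs_rescaleDist_sub_le hC hN hS
  refine ⟨fun ρ => 3 * η ρ, fun ρ => mul_pos three_pos (hη_pos ρ),
    hη_anti.const_mul zero_le_three, by simpa using hη_lim.const_mul 3, fun ρ =>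
    VecNorm.isHausdorffApprox_toClosedBall ν (hd.rescaleDist ρ.2) (μ ρ) hR (hη_pos ρ)
      (.inr (by simpa using hR.le)) (fun x hx => .inl (mem_closedBall_zero_iff.2 (hr ρ ρ.2 x hx)))
      (fun x hx => .inr (by simpa using hx)) (hη ρ)⟩

theorem mainTheorem9_general {ι : Type*} [Finite ι] (b : Module.Basis ι ℝ (Eucl n))
    (hd : IsBilipDist d)
    (hdb : ∀ v ∈ Submodule.span ℤ (range b), ∀ x y, d (x + v) (y + v) = d x y)
    (μ : Measure (Eucl n)) [IsFiniteMeasureOnCompacts μ]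
    [VAddInvariantMeasure (Submodule.span ℤ (range b)).toAddSubgroup (Eucl n) μ] (hR : 0 < R) :
    ∃ N : VecNorm n, (∀ x, Tendsto (fun ρ : ℝ => d 0 (ρ • x) / ρ) atTop (𝓝 (N x))) ∧
      MGHConverges (A := Ioi (0 : ℝ))
        (fun ρ => (hd.rescaleDist ρ.2).closedBall (rescaleMeasure μ ρ) R)
        (N.closedBall (averagedMeasure b volume μ) R) := by
  obtain ⟨C, hC⟩ := hd.exists_abs_sub_le_of_periodic b hdb
  obtain ⟨N, hN⟩ := hd.exists_vecNorm_tendsto hC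
  obtain ⟨ε, hε_pos, hε_anti, hε_lim, hε⟩ := exists_antitone_isHausdorffApprox_toClosedBall hd hC hN
    (fun ρ => rescaleMeasure μ ρ) (averagedMeasure b volume μ) hR
  have hcont := N.continuous_toClosedBall (averagedMeasure b volume μ) hR
  refine ⟨N, hN, ε, _, hε_pos, hε_anti, hε_lim,
    fun ρ => hcont.measurable.comp measurable_subtype_coe, hε, fun u => ?_⟩
  obtain ⟨M, hM⟩ := isCompact_univ.exists_bound_of_continuousOn u.continuous.continuousOn
  rw [N.integral_closedBall _ hR]
  refine (tendsto_integral_rescaleMeasure_of_rescaleDist_le hd hC hN b μ hR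
    (u.continuous.comp hcont) fun x => hM _ (mem_univ _)).congr fun ρ => ?_
  exact ((hd.rescaleDist ρ.2).integral_closedBall _ R fun x => u (N.toClosedBall _ hR.le x)).symm

end RescaledBalls

section Invariance

lemma vaddInvariantMeasure_withDensity {M α : Type*} [MeasurableSpace α] [VAdd M α]
    [MeasurableConstVAdd M α] {μ : Measure α} [VAddInvariantMeasure M α μ] {f : α → ℝ≥0∞}
    (hf : Measurable f) (hinv : ∀ (c : M) (x : α), f (c +ᵥ x) = f x) :
    VAddInvariantMeasure M α (μ.withDensity f) where
  measure_preimage_vadd c s hs := by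
    rw [withDensity_apply _ (hs.preimage (measurable_const_vadd c)), withDensity_apply _ hs,
      ← (measurePreserving_vadd c μ).setLIntegral_comp_preimage hs hf]
    simp only [hinv]

lemma rescaleMeasure_withDensity {E : Type*} [NormedAddCommGroup E] [NormedSpace ℝ E]
    [FiniteDimensional ℝ E] [MeasurableSpace E] [BorelSpace E] (ν : Measure E)
    [ν.IsAddHaarMeasure] {f : E → ℝ≥0∞} (hf : Measurable f) {ρ : ℝ} (hρ : 0 < ρ) :
    rescaleMeasure (ν.withDensity f) ρ = ν.withDensity fun x => f (ρ • x) := by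
  have hemb : MeasurableEmbedding fun x : E => ρ • x := measurableEmbedding_const_smul₀ hρ.ne'
  ext s hs
  have himage := hemb.measurableSet_image.2 hs
  rw [rescaleMeasure, Measure.smul_apply, hemb.comap_apply, withDensity_apply _ himage,
    withDensity_apply _ hs, ← preimage_image_eq s hemb.injective,
    ← setLIntegral_map himage hf hemb.measurable, Measure.map_addHaar_smul ν hρ.ne',
    abs_of_pos (by positivity), setLIntegral_smul_measure, preimage_image_eq s hemb.injective]

variable {F : Type*} [NormedAddCommGroup F] [InnerProductSpace ℝ F] {g : SmoothMetric F} {k : F}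

lemma riemannianEDistOf_add_right_le (hk : ∀ x v : F, g.inner (x + k) v v = g.inner x v v)
    (x y : F) : riemannianEDistOf g (x + k) (y + k) ≤ riemannianEDistOf g x y := by
  rw [riemannianEDistOf_eq, riemannianEDistOf_eq]
  refine le_iInf₂ fun γ hγ => ?_
  have htranslate : ContMDiff 𝓘(ℝ, F) 𝓘(ℝ, F) 1 fun z : F => z + k :=
    (contDiff_id.add contDiff_const).contMDiff
  refine (iInf₂_le (γ.map htranslate.continuous) (htranslate.comp hγ)).trans_eq
    (lintegral_congr fun t => ?_)
  have hderiv : mfderiv (𝓡∂ 1) 𝓘(ℝ, F) (γ.map htranslate.continuous) t =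
      mfderiv (𝓡∂ 1) 𝓘(ℝ, F) γ t := by
    refine (mfderiv_comp (I := 𝓡∂ 1) (I' := 𝓘(ℝ, F)) (I'' := 𝓘(ℝ, F)) t
      (htranslate.mdifferentiableAt one_ne_zero) (hγ.mdifferentiableAt one_ne_zero)).trans ?_
    rw [mfderiv_eq_fderiv, fderiv_add_const, fderiv_fun_id]
    exact ContinuousLinearMap.id_comp _
  rw [hderiv]
  exact congrArg (fun r => ENNReal.ofReal √r) (hk (γ t) (mfderiv (𝓡∂ 1) 𝓘(ℝ, F) γ t 1))

lemma riemannianEDistOf_add_right (hk : ∀ x v : F, g.inner (x + k) v v = g.inner x v v)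
    (x y : F) : riemannianEDistOf g (x + k) (y + k) = riemannianEDistOf g x y := by
  refine (riemannianEDistOf_add_right_le hk x y).antisymm ?_
  have hneg (x v : F) : g.inner (x + -k) v v = g.inner x v v := by
    have h := hk (x + -k) v
    rw [neg_add_cancel_right] at h
    exact h.symm
  simpa only [add_neg_cancel_right] using riemannianEDistOf_add_right_le hneg (x + k) (y + k)

end Invariance

namespace RiemMetric

variable {n : ℕ} (g : RiemMetric n)

/-- The density `√det(g(eᵢ, eⱼ))` of the Riemannian measure of `g` with respect to the Lebesgue
measure. -/
noncomputable def density (x : Eucl n) : ℝ :=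
  √(Matrix.of fun i j : Fin n =>
    g.form x (EuclideanSpace.single i 1) (EuclideanSpace.single j 1)).det

lemma continuous_density : Continuous g.density := by
  have := g.contDiff.continuous
  refine Real.continuous_sqrt.comp (Continuous.matrix_det (continuous_matrix fun i j => ?_))
  simp only [Matrix.of_apply]
  fun_prop

lemma density_rescale {ρ : ℝ} (hρ : 0 < ρ) (x : Eucl n) :
    (g.rescale ρ hρ).density x = g.density (ρ • x) := by
  simp only [density, rescale, smul_homothetyPullback hρ]

lemma measure_rescale {ρ : ℝ} (hρ : 0 < ρ) :
    (g.rescale ρ hρ).measure = rescaleMeasure g.measure ρ := by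
  refine Eq.trans ?_ (rescaleMeasure_withDensity volume
    g.continuous_density.measurable.ennreal_ofReal hρ).symm
  simp only [← density_rescale _ hρ]
  rfl

variable {g}

namespace IsPeriodic

lemma form_add (hg : g.IsPeriodic) {v : Eucl n}
    (hv : v ∈ Submodule.span ℤ (range (EuclideanSpace.basisFun (Fin n) ℝ).toBasis)) (x : Eucl n) :
    g.form (x + v) = g.form x := by
  choose k hk using ((EuclideanSpace.basisFun (Fin n) ℝ).toBasis.mem_span_iff_repr_mem ℤ v).1 hv
  rw [← hg k x]
  congr 2
  ext i
  simpa using (hk i).symm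

lemma dist_add (hg : g.IsPeriodic) {v : Eucl n}
    (hv : v ∈ Submodule.span ℤ (range (EuclideanSpace.basisFun (Fin n) ℝ).toBasis))
    (x y : Eucl n) : g.dist (x + v) (y + v) = g.dist x y :=
  congrArg ENNReal.toReal
    (riemannianEDistOf_add_right (fun z w => congrArg (· w w) (hg.form_add hv z)) x y)

lemma density_vadd (hg : g.IsPeriodic)
    (v : (Submodule.span ℤ (range (EuclideanSpace.basisFun (Fin n) ℝ).toBasis)).toAddSubgroup)
    (x : Eucl n) : g.density (v +ᵥ x) = g.density x := by
  simp only [density, AddSubgroup.vadd_def, vadd_eq_add, add_comm (v : Eucl n), hg.form_add v.2]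

lemma vaddInvariantMeasure (hg : g.IsPeriodic) :
    VAddInvariantMeasure
      (Submodule.span ℤ (range (EuclideanSpace.basisFun (Fin n) ℝ).toBasis)).toAddSubgroup
      (Eucl n) g.measure :=
  vaddInvariantMeasure_withDensity g.continuous_density.measurable.ennreal_ofReal fun v x =>
    congrArg ENNReal.ofReal (hg.density_vadd v x)

lemma rescaledBall_eq_closedBall (hg : g.IsPeriodic) {ρ : ℝ} (hρ : 0 < ρ) (R : ℝ) :
    g.rescaledBall hg ρ hρ R =
      (hg.isBilipDist.rescaleDist hρ).closedBall (rescaleMeasure g.measure ρ) R := by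
  simp only [rescaledBall, measure_rescale]
  rfl

end IsPeriodic

end RiemMetric

theorem mainTheorem9 (n : ℕ) (g : RiemMetric n) (hg : g.IsPeriodic) :
    ∃ N : VecNorm n, g.IsStableNorm N ∧
      MGHConverges (A := Set.Ioi (0 : ℝ)) (fun ρ => g.rescaledBall hg ρ.1 ρ.2 1)
        (N.closedBall g.limitMeasure 1) := by
  have := hg.vaddInvariantMeasure
  exact (funext fun ρ : Ioi (0 : ℝ) => hg.rescaledBall_eq_closedBall ρ.2 1) ▸
    mainTheorem9_general _ hg.isBilipDist (fun _ hv => hg.dist_add hv) g.measure one_pos
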